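/- Fix an integer $k\ge 2$. For $n$ a multiple of $k$, let $\Theta_A$ be the set of maps $x:\{1,\dots,n\}\to\{e^{2\pi \mathbf i j/k}: 0\le j<k\}$ taking each of the $k$ values exactly $n/k$ times, and for $z\in\Theta_A$ let $\theta(z)$ be the set of those $x\in\Theta_A$ for which there is a real $\alpha$ with $e^{\mathbf i\alpha}x=z$. Put $\mathbf P(x)=\mathbf x\bar{\mathbf x}^t$, the $n\times n$ matrix with entries $x(a)\overline{x(b)}$. For each such $n$ let $y\in\Theta_A$ be the true assignment and let $$\mathbf U=\mathbf P(y)+\sigma\mathbf W_c,$$ where $\sigma=\sigma_n\in\mathbb R$ is deterministic and $\mathbf W_c$ is a standard GUE matrix: a random Hermitian matrix whose entries on and above the diagonal are independent, the diagonal entries being $\mathcal N(0,1)_{\mathbb R}$ and the entries above the diagonal standard complex Gaussian (real and imaginary parts independent $\mathcal N(0,1/2)$). Let $y^A=y^A(\mathbf U)$ be the maximum likelihood estimator $$y^A\in\operatorname{argmin}_{x\in\Theta_A}\|\mathbf U-\mathbf P(x)\|_F^2,$$ where $\|\cdot\|_F$ is the Frobenius norm and the minimizer is chosen in an arbitrary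 way. Let $\delta>0$ be independent of $n$. (a) If $$\sigma^2<\frac{(1-\delta)\,n\left(1-\cos\frac{2\pi}{k}\right)}{2\log n}$$ for all sufficiently large $n$ divisible by $k$, then $\Pr(y^A\in\theta(y))\to 1$ as $n\to\infty$ along the multiples of $k$. (b) If $$\sigma^2>\frac{(1+\delta)\,n\left(1-\cos\frac{2\pi}{k}\right)}{2\log n}$$ for all sufficiently large $n$ divisible by $k$, then $\Pr(y^A\in\theta(y))\to 0$ as $n\to\infty$ along the multiples of $k$. -/

import Mathlib

open MeasureTheory ProbabilityTheory Filter Topology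

/-- The `j`-th color `exp (2 π i j / k)`, `j = 0, …, k - 1`: the `k`-th roots of unity. -/
noncomputable def color (k : ℕ) (j : Fin k) : ℂ :=
  Complex.exp (2 * Real.pi * Complex.I * (j : ℕ) / k)

/-- The color assignments `x : [n] → {k-th roots of unity}` whose `k` color classes all have the
same size `n / k`. -/
def balancedAssignments (n k : ℕ) : Set (Fin n → ℂ) :=
  {x | (∀ i, x i ∈ Set.range (color k)) ∧ ∀ j : Fin k, k * Nat.card {i // x i = color k j} = n}

/-- The equivalence class of `y` in the set of balanced assignments: those `x` with
`exp (i α) x = y` for some fixed angle `α`. -/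
def phaseClass {n : ℕ} (k : ℕ) (y : Fin n → ℂ) : Set (Fin n → ℂ) :=
  {x | x ∈ balancedAssignments n k ∧
    ∃ α : ℝ, ∀ i, Complex.exp (Complex.I * α) * x i = y i}

/-- The matrix `P(x) = x x̄ᵗ`, with entries `x a * conj (x b)`. -/
def phaseMatrix {n : ℕ} (x : Fin n → ℂ) : Matrix (Fin n) (Fin n) ℂ :=
  Matrix.vecMulVec x (star x)

/-- The squared Frobenius norm of a complex square matrix. -/
noncomputable def frobSq {n : ℕ} (A : Matrix (Fin n) (Fin n) ℂ) : ℝ :=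
  ∑ i, ∑ j, ‖A i j‖ ^ 2

/-- The set `argmin ‖U - P(x)‖_F ^ 2` over the balanced assignments `x`. -/
def argminSet {n : ℕ} (k : ℕ) (U : Matrix (Fin n) (Fin n) ℂ) : Set (Fin n → ℂ) :=
  {x | x ∈ balancedAssignments n k ∧
    ∀ z ∈ balancedAssignments n k, frobSq (U - phaseMatrix x) ≤ frobSq (U - phaseMatrix z)}

/-- `yhat` is a maximum likelihood estimator: for every observation `U` it returns one of the
minimizers (whose phase rotations are minimizers too), chosen arbitrarily among them. -/
def IsMLE {n : ℕ} (k : ℕ) (yhat : Matrix (Fin n) (Fin n) ℂ → Fin n → ℂ) : Prop :=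
  ∀ U, yhat U ∈ argminSet k U

/-- The standard complex Gaussian law: real and imaginary part are independent centered real
Gaussians of variance `1 / 2`. -/
noncomputable def stdComplexGaussian : Measure ℂ :=
  ((gaussianReal 0 (1 / 2)).prod (gaussianReal 0 (1 / 2))).map
    (fun p : ℝ × ℝ => (p.1 : ℂ) + p.2 * Complex.I)

/-- `W` is a standard GUE matrix: Hermitian, with standard real Gaussian diagonal entries,
standard complex Gaussian entries above the diagonal, and all of these entries independent. -/
structure IsGUE {Ω : Type*} [MeasurableSpace Ω] (μ : Measure Ω) {n : ℕ}
    (W : Ω → Matrix (Fin n) (Fin n) ℂ) : Prop where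
  hermitian : ∀ᵐ ω ∂μ, (W ω).IsHermitian
  diag : ∀ i, HasLaw (fun ω => (W ω i i).re) (gaussianReal 0 1) μ
  upper : ∀ i j, i < j → HasLaw (fun ω => W ω i j) stdComplexGaussian μ
  indep : iIndepFun (fun (p : {p : Fin n × Fin n // p.1 ≤ p.2}) (ω : Ω) => W ω p.1.1 p.1.2) μ

/-- The observation `U = P(y) + σ W`. -/
def observation {n : ℕ} (y : Fin n → ℂ) (σ : ℝ) (W : Matrix (Fin n) (Fin n) ℂ) :
    Matrix (Fin n) (Fin n) ℂ :=
  phaseMatrix y + (σ : ℂ) • W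

/-- The critical value `n (1 - cos (2 π / k)) / (2 log n)` of `σ ^ 2`. -/
noncomputable def criticalVariance (n k : ℕ) : ℝ :=
  n * (1 - Real.cos (2 * Real.pi / k)) / (2 * Real.log n)

/-! All matrices `P(x)` have the same Frobenius norm, so the estimator maximizes the pairing of `U`
with `P(x)`. An assignment `x` does at least as well as `y` exactly when `σ⟨W, P(x) - P(y)⟩ ≥ D`,
where `D = n² - |⟨x, y⟩|²` is `signalGap y x`. The left side is a centered Gaussian of variance
`2σ²D`, so this has probability at most `exp(-D / (4σ²))`. Write `β = 1 - cos(2π/k)`.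

Below the threshold a union bound suffices. With `z = x ȳ`, `D` is at least `β` times the number of
ordered pairs on which `z` differs (`card_mul_le_signalGap`). If `x` differs from some rotation of
`y` at `l ≤ εn` places, then `D ≥ 2β(1-ε)nl`, and the sum over such `x` is controlled by a binomial
generating function. Otherwise `D ≥ βεn²`, and the exponent, of order `n log n`, beats the `kⁿ`
assignments (`sum_exp_neg_signalGap_le`, `unionBound_le`).

Above the threshold a single swap of two vertices of adjacent colors already beats `y`
(`IsGUE.measureReal_forall_swap_le`). Such a swap costs at most `4nβ`. Its noise splits, up to a
small remainder, into one term for each swapped vertex. If the candidates are confined to a small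
set `H` and `y` is replaced by its restriction off `H`, these terms are independent Gaussians of
variance close to `4βn`. The best vertex on each side then gives about `√(8βn log n)`, and
`2|σ|√(8βn log n) > 4nβ` is the condition `σ² > nβ / (2 log n)`. -/

/-- The real inner product of complex matrices whose norm is the Frobenius norm. -/
noncomputable def frobPair {n : ℕ} (U A : Matrix (Fin n) (Fin n) ℂ) : ℝ :=
  ∑ i, ∑ j, (star (U i j) * A i j).re

/-! ### Gaussian laws through characteristic functions. -/

section GaussianLaw

variable {Ω : Type*} [MeasurableSpace Ω] {μ : Measure Ω}

lemma hasLaw_gaussianReal_of_charFun [IsFiniteMeasure μ] {X : Ω → ℝ} (hX : AEMeasurable X μ) (v : NNReal)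
    (h : ∀ t, charFun (μ.map X) t = Complex.exp (-(v * t ^ 2 / 2 : ℝ))) :
    HasLaw X (gaussianReal 0 v) μ := by
  refine ⟨hX, Measure.ext_of_charFun ?_⟩
  ext t
  rw [h, charFun_gaussianReal]
  congr 1
  push_cast
  simp

lemma charFun_map_of_hasLaw_gaussianReal {X : Ω → ℝ} {v : NNReal}
    (hX : HasLaw X (gaussianReal 0 v) μ) (t : ℝ) :
    charFun (μ.map X) t = Complex.exp (-(v * t ^ 2 / 2 : ℝ)) := by
  rw [hX.map_eq, charFun_gaussianReal]
  congr 1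
  push_cast
  simp

/-- The factor 2 accounts for an off-diagonal entry and its conjugate, which contribute equally to a
pairing of Hermitian matrices. -/
lemma stdComplexGaussian_hasLaw_re_mul (α : ℂ) :
    HasLaw (fun w : ℂ => 2 * (star w * α).re) (gaussianReal 0 (2 * ‖α‖ ^ 2).toNNReal)
      stdComplexGaussian := by
  have hm : Measurable (fun w : ℂ => 2 * (star w * α).re) := by fun_prop
  have hm' : Measurable (fun p : ℝ × ℝ => (p.1 : ℂ) + p.2 * Complex.I) := by fun_prop
  refine ⟨hm.aemeasurable, ?_⟩
  rw [stdComplexGaussian, Measure.map_map hm hm']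
  have h1 : HasLaw (fun p : ℝ × ℝ => (2 * α.re) * p.1)
      (gaussianReal 0 (.mk ((2 * α.re) ^ 2) (sq_nonneg _) * (1 / 2)))
      ((gaussianReal 0 (1 / 2)).prod (gaussianReal 0 (1 / 2))) := by
    have := gaussianReal_const_mul (measurePreserving_fst (μ := gaussianReal 0 (1 / 2))
      (ν := gaussianReal 0 (1 / 2))).hasLaw (2 * α.re)
    simpa using this
  have h2 : HasLaw (fun p : ℝ × ℝ => (2 * α.im) * p.2)
      (gaussianReal 0 (.mk ((2 * α.im) ^ 2) (sq_nonneg _) * (1 / 2)))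
      ((gaussianReal 0 (1 / 2)).prod (gaussianReal 0 (1 / 2))) := by
    have := gaussianReal_const_mul (measurePreserving_snd (μ := gaussianReal 0 (1 / 2))
      (ν := gaussianReal 0 (1 / 2))).hasLaw (2 * α.im)
    simpa using this
  have hi : IndepFun (fun p : ℝ × ℝ => (2 * α.re) * p.1) (fun p : ℝ × ℝ => (2 * α.im) * p.2)
      ((gaussianReal 0 (1 / 2)).prod (gaussianReal 0 (1 / 2))) :=
    indepFun_prod (X := fun x : ℝ => (2 * α.re) * x) (Y := fun x : ℝ => (2 * α.im) * x)
      (by fun_prop) (by fun_prop)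
  have h3 := gaussianReal_add_gaussianReal_of_indepFun hi h1.map_eq h2.map_eq
  convert! h3 using 2
  · ext p
    simp
    ring
  · simp
  · ext
    simp [← Complex.normSq_eq_norm_sq, Complex.normSq_apply]
    rw [max_eq_left (by nlinarith [mul_self_nonneg α.re, mul_self_nonneg α.im])]
    ring

lemma iIndepFun_hasLaw_sum_gaussianReal {ι : Type*} [Fintype ι] {X : ι → Ω → ℝ} {v : ι → NNReal}
    (hX : ∀ i, HasLaw (X i) (gaussianReal 0 (v i)) μ) (hi : iIndepFun X μ) :
    HasLaw (fun ω => ∑ i, X i ω) (gaussianReal 0 (∑ i, v i)) μ := by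
  have := hi.isProbabilityMeasure
  have hm : ∀ i, AEMeasurable (X i) μ := fun i => (hX i).aemeasurable
  refine hasLaw_gaussianReal_of_charFun (by fun_prop) _ fun t => ?_
  rw [hi.charFun_map_fun_sum_eq_prod hm, Finset.prod_apply]
  simp_rw [charFun_map_of_hasLaw_gaussianReal (hX _), ← Complex.exp_sum]
  congr 1
  push_cast
  rw [Finset.sum_neg_distrib, Finset.sum_mul, Finset.sum_div]

end GaussianLaw

/-! ### Algebra of the Frobenius pairing. -/

section Pairing

variable {n : ℕ}

lemma frobSq_nonneg (A : Matrix (Fin n) (Fin n) ℂ) : 0 ≤ frobSq A := by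
  unfold frobSq; positivity

lemma frobPair_add (U A B : Matrix (Fin n) (Fin n) ℂ) :
    frobPair U (A + B) = frobPair U A + frobPair U B := by
  simp [frobPair, mul_add, Finset.sum_add_distrib]

lemma frobPair_smul (U A : Matrix (Fin n) (Fin n) ℂ) (c : ℝ) :
    frobPair U ((c : ℂ) • A) = c * frobPair U A := by
  simp only [frobPair, Finset.mul_sum]
  refine Finset.sum_congr rfl fun i _ => Finset.sum_congr rfl fun j _ => ?_
  simp
  ring

lemma frobPair_sub (U A B : Matrix (Fin n) (Fin n) ℂ) :
    frobPair U (A - B) = frobPair U A - frobPair U B := by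
  simp only [frobPair, Matrix.sub_apply, mul_sub, Complex.sub_re, Finset.sum_sub_distrib]

lemma frobPair_sum {ι : Type*} (s : Finset ι) (U : Matrix (Fin n) (Fin n) ℂ)
    (A : ι → Matrix (Fin n) (Fin n) ℂ) :
    frobPair U (∑ q ∈ s, A q) = ∑ q ∈ s, frobPair U (A q) := by
  classical
  induction s using Finset.induction_on with
  | empty => simp [frobPair]
  | insert a s ha ih => rw [Finset.sum_insert ha, Finset.sum_insert ha, frobPair_add, ih]

lemma frobPair_comm (U A : Matrix (Fin n) (Fin n) ℂ) : frobPair U A = frobPair A U := by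
  simp only [frobPair]
  refine Finset.sum_congr rfl fun i _ => Finset.sum_congr rfl fun j _ => ?_
  simp
  ring

lemma frobPair_self (A : Matrix (Fin n) (Fin n) ℂ) : frobPair A A = frobSq A := by
  simp only [frobPair, frobSq]
  refine Finset.sum_congr rfl fun i _ => Finset.sum_congr rfl fun j _ => ?_
  rw [← Complex.normSq_eq_norm_sq, Complex.normSq_apply]
  simp

/-- A sum over all entries of a symmetric array in terms of its diagonal and upper triangle. -/
lemma sum_sum_eq_sum_upper (f : Fin n → Fin n → ℝ) (hf : ∀ i j, f i j = f j i) :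
    ∑ i, ∑ j, f i j =
      ∑ p : {p : Fin n × Fin n // p.1 ≤ p.2},
        (if p.1.1 = p.1.2 then f p.1.1 p.1.2 else 2 * f p.1.1 p.1.2) := by
  classical
  have h1 : ∑ i, ∑ j, f i j = ∑ p : Fin n × Fin n, f p.1 p.2 :=
    (Fintype.sum_prod_type' f).symm
  rw [h1, ← Finset.sum_filter_add_sum_filter_not Finset.univ (fun p : Fin n × Fin n => p.1 ≤ p.2)]
  have h2 : ∑ p : Fin n × Fin n with ¬ p.1 ≤ p.2, f p.1 p.2 =
      ∑ p : Fin n × Fin n with p.1 ≤ p.2, if p.1 = p.2 then 0 else f p.1 p.2 := by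
    rw [Finset.sum_ite, Finset.sum_const_zero, zero_add, Finset.filter_filter]
    refine Finset.sum_nbij' (fun p => p.swap) (fun p => p.swap) ?_ ?_ ?_ ?_ ?_
    · rintro ⟨a, b⟩; simp; grind
    · rintro ⟨a, b⟩; simp; grind
    · simp
    · simp
    · rintro ⟨a, b⟩ _; exact hf _ _
  rw [h2, ← Finset.sum_add_distrib, ← Finset.sum_subtype_eq_sum_filter]
  simp only [Finset.subtype_univ]
  refine Finset.sum_congr rfl fun p _ => ?_
  split_ifs <;> ring

end Pairing

/-! ### Law of a linear functional of a GUE matrix. -/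

section GUE

variable {Ω : Type*} [MeasurableSpace Ω] {μ : Measure Ω} {n : ℕ}
  {W : Ω → Matrix (Fin n) (Fin n) ℂ}

/-- The Frobenius pairing of a GUE matrix with a fixed Hermitian matrix `A` is a centered Gaussian
of variance `‖A‖ ^ 2`. -/
theorem IsGUE.hasLaw_frobPair (hW : IsGUE μ W) {A : Matrix (Fin n) (Fin n) ℂ}
    (hA : A.IsHermitian) :
    HasLaw (fun ω => frobPair (W ω) A) (gaussianReal 0 (frobSq A).toNNReal) μ := by
  classical
  -- `T p` is the contribution of the entry `p` on or above the diagonal together with its mirror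
  -- image; these contributions are independent.
  let T : {p : Fin n × Fin n // p.1 ≤ p.2} → ℂ → ℝ := fun p w =>
    if p.1.1 = p.1.2 then (A p.1.1 p.1.2).re * w.re else 2 * (star w * A p.1.1 p.1.2).re
  have hT : ∀ p, Measurable (T p) := by
    intro p
    by_cases h : p.1.1 = p.1.2
    · simp only [T, h, if_true]; fun_prop
    · simp only [T, h, if_false]; fun_prop
  have hind := hW.indep.comp T hT
  -- The diagonal of `A` is real, so only the real part of `W i i` enters, and that is the part
  -- whose law is given.
  have hdiag : ∀ i, (A i i).im = 0 := fun i => by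
    have := congrFun (congrFun hA i) i
    rw [Matrix.conjTranspose_apply] at this
    exact Complex.conj_eq_iff_im.1 this
  let v : {p : Fin n × Fin n // p.1 ≤ p.2} → NNReal := fun p =>
    (if p.1.1 = p.1.2 then ‖A p.1.1 p.1.2‖ ^ 2 else 2 * ‖A p.1.1 p.1.2‖ ^ 2).toNNReal
  have hlaw : ∀ p, HasLaw (T p ∘ fun ω => W ω p.1.1 p.1.2) (gaussianReal 0 (v p)) μ := by
    rintro ⟨⟨i, j⟩, hij⟩
    by_cases h : i = j
    · subst h
      have := gaussianReal_const_mul (hW.diag i) (A i i).re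
      convert! this using 1
      · ext ω; simp [T]
      · congr 1
        · simp
        · ext
          simp [v, ← Complex.normSq_eq_norm_sq, Complex.normSq_apply, hdiag]
          ring_nf
          exact max_eq_left (sq_nonneg _)
    · have := (stdComplexGaussian_hasLaw_re_mul (A i j)).comp
        (hW.upper i j (lt_of_le_of_ne hij h))
      convert! this using 1
      · ext ω; simp [T, h]
      · simp [v, h]
  have hsum := iIndepFun_hasLaw_sum_gaussianReal hlaw hind
  have hv : ∑ p, v p = (frobSq A).toNNReal := by
    rw [← Real.toNNReal_sum_of_nonneg]
    · congr 1
      rw [frobSq, sum_sum_eq_sum_upper]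
      intro i j
      rw [← hA.apply i j, norm_star]
    · intros; split_ifs <;> positivity
  rw [hv] at hsum
  refine hsum.congr ?_
  filter_upwards [hW.hermitian] with ω hω
  rw [frobPair, sum_sum_eq_sum_upper]
  · refine Finset.sum_congr rfl fun p _ => ?_
    obtain ⟨⟨i, j⟩, hij⟩ := p
    by_cases h : i = j
    · subst h
      simp [T, hdiag, mul_comm]
    · simp [T, h]
  · intro i j
    rw [← hA.apply i j, ← hω.apply i j]
    simp

end GUE

/-! ### Independence from orthogonality. -/

section Independence

variable {Ω : Type*} [MeasurableSpace Ω] {μ : Measure Ω} {n : ℕ}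
  {W : Ω → Matrix (Fin n) (Fin n) ℂ}

lemma frobSq_sum_smul_of_orthogonal {ι : Type*} [Fintype ι] (A : ι → Matrix (Fin n) (Fin n) ℂ)
    (hA : ∀ q r, q ≠ r → frobPair (A q) (A r) = 0) (t : ι → ℝ) :
    frobSq (∑ q, (t q : ℂ) • A q) = ∑ q, t q ^ 2 * frobSq (A q) := by
  classical
  rw [← frobPair_self, frobPair_sum]
  refine Finset.sum_congr rfl fun q _ => ?_
  rw [frobPair_smul, frobPair_comm, frobPair_sum, Finset.sum_eq_single q]
  · rw [frobPair_smul, frobPair_self]; ring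
  · intro r _ hr
    rw [frobPair_smul, hA q r hr.symm, mul_zero]
  · simp

/-- The pairings of a GUE matrix with orthogonal Hermitian matrices are independent. -/
theorem IsGUE.iIndepFun_frobPair [IsProbabilityMeasure μ] (hW : IsGUE μ W) {ι : Type*} [Fintype ι]
    {A : ι → Matrix (Fin n) (Fin n) ℂ} (hA : ∀ q, (A q).IsHermitian)
    (hAo : ∀ q r, q ≠ r → frobPair (A q) (A r) = 0) :
    iIndepFun (fun q ω => frobPair (W ω) (A q)) μ := by
  have hm : ∀ q, AEMeasurable (fun ω => frobPair (W ω) (A q)) μ :=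
    fun q => (hW.hasLaw_frobPair (hA q)).aemeasurable
  rw [iIndepFun_iff_charFun_pi hm]
  intro t
  have hB : (∑ q, ((t q : ℝ) : ℂ) • A q).IsHermitian := by
    rw [Matrix.IsHermitian, Matrix.conjTranspose_sum]
    refine Finset.sum_congr rfl fun q _ => ?_
    rw [Matrix.conjTranspose_smul, (hA q).eq]
    simp
  have hlaw := hW.hasLaw_frobPair hB
  -- The joint characteristic function at `t` is that of the pairing with the single Hermitian
  -- matrix `∑ t_q A_q`, evaluated at 1. Orthogonality makes its variance additive, so it
  -- factorizes.
  have h1 : charFun (μ.map (fun ω => WithLp.toLp 2 (fun q => frobPair (W ω) (A q)))) t =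
      charFun (μ.map (fun ω => frobPair (W ω) (∑ q, ((t q : ℝ) : ℂ) • A q))) 1 := by
    rw [charFun_apply, charFun_apply, integral_map (by fun_prop) (by fun_prop),
      integral_map hlaw.aemeasurable (by fun_prop)]
    refine integral_congr_ae (Eventually.of_forall fun ω => ?_)
    simp only [frobPair_sum, frobPair_smul, PiLp.inner_apply]
    simp
  rw [h1, charFun_map_of_hasLaw_gaussianReal hlaw]
  simp_rw [charFun_map_of_hasLaw_gaussianReal (hW.hasLaw_frobPair (hA _)), ← Complex.exp_sum]
  simp only [Real.coe_toNNReal _ (frobSq_nonneg _)]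
  rw [frobSq_sum_smul_of_orthogonal A hAo]
  congr 1
  push_cast
  rw [Finset.sum_neg_distrib, ← Finset.sum_div]
  simp [mul_comm]

end Independence

/-! ### Gaussian tail bounds. -/

section Tails

variable {Ω : Type*} [MeasurableSpace Ω] {μ : Measure Ω} {X : Ω → ℝ} {v : NNReal}

lemma measureReal_ge_le_exp_of_hasLaw_gaussianReal [IsProbabilityMeasure μ]
    (hX : HasLaw X (gaussianReal 0 v) μ) (ε : ℝ) {t : ℝ} (ht : 0 ≤ t) :
    μ.real {ω | ε ≤ X ω} ≤ Real.exp (-t * ε + v * t ^ 2 / 2) := by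
  have hint : Integrable (fun ω => Real.exp (t * X ω)) μ := by
    have := integrable_exp_mul_gaussianReal (μ := 0) (v := v) t
    rw [← hX.map_eq] at this
    exact this.comp_aemeasurable hX.aemeasurable
  refine (measure_ge_le_exp_mul_mgf ε ht hint).trans_eq ?_
  rw [mgf_gaussianReal hX.map_eq, ← Real.exp_add]
  ring_nf

/-- The density is bounded below on the unit interval `(z, z+1]` by its value at the right end. The
loss from `z` to `z+1` does not affect the leading exponent. -/
lemma exp_le_gaussianReal_Ioi {z : ℝ} (hz : 0 ≤ z) :
    (√(2 * Real.pi))⁻¹ * Real.exp (-(z + 1) ^ 2 / 2) ≤ (gaussianReal 0 1).real (Set.Ioi z) := by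
  have h1 : (gaussianReal 0 1).real (Set.Ioc z (z + 1)) ≤ (gaussianReal 0 1).real (Set.Ioi z) :=
    measureReal_mono Set.Ioc_subset_Ioi_self
  refine le_trans ?_ h1
  rw [measureReal_def, gaussianReal_apply_eq_integral 0 one_ne_zero, ENNReal.toReal_ofReal
    (integral_nonneg fun x => gaussianPDFReal_nonneg 0 1 x)]
  have h2 : ∫ x in Set.Ioc z (z + 1), (√(2 * Real.pi))⁻¹ * Real.exp (-(z + 1) ^ 2 / 2) =
      (√(2 * Real.pi))⁻¹ * Real.exp (-(z + 1) ^ 2 / 2) := by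
    simp
  rw [← h2]
  refine setIntegral_mono_on
    (continuousOn_const.integrableOn_Icc.mono_set Set.Ioc_subset_Icc_self) (integrable_gaussianPDFReal 0 1).integrableOn
    measurableSet_Ioc fun x hx => ?_
  simp only [gaussianPDFReal, NNReal.coe_one, mul_one, sub_zero]
  gcongr
  · exact hz.trans hx.1.le
  · exact hx.2

lemma exp_le_measureReal_gt_of_hasLaw_gaussianReal [IsProbabilityMeasure μ]
    (hX : HasLaw X (gaussianReal 0 v) μ) (hv : 0 < v) {z u : ℝ} (hz : 0 ≤ z)
    (hu : u ≤ z * √v) :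
    (√(2 * Real.pi))⁻¹ * Real.exp (-(z + 1) ^ 2 / 2) ≤ μ.real {ω | u < X ω} := by
  have hs : (0 : ℝ) < √v := Real.sqrt_pos.2 (by exact_mod_cast hv)
  have h := gaussianReal_const_mul hX (√v)⁻¹
  have hv1 : NNReal.mk ((√v)⁻¹ ^ 2) (sq_nonneg _) * v = 1 := by
    ext
    simp [inv_pow, hv.ne']
  rw [hv1, mul_zero] at h
  refine (exp_le_gaussianReal_Ioi hz).trans ?_
  have h3 := h.measureReal_eq (p := fun x => z < x) measurableSet_Ioi
  have h4 : {x | z < x} = Set.Ioi z := rfl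
  rw [← h4, ← h3]
  refine measureReal_mono fun ω hω => ?_
  simp only [Set.mem_ofPred_eq] at hω ⊢
  rw [inv_mul_eq_div, lt_div_iff₀ hs] at hω
  linarith

/-- Independence gives a product of factors at most `1 - q ≤ exp(-q)`. -/
lemma measureReal_forall_le_le_exp {ι : Type*} (S : Finset ι) [IsProbabilityMeasure μ]
    {X : ι → Ω → ℝ} (hm : ∀ i, AEMeasurable (X i) μ) (hi : iIndepFun X μ) {u q : ℝ}
    (hq : ∀ i ∈ S, q ≤ μ.real {ω | u < X i ω}) :
    μ.real {ω | ∀ i ∈ S, X i ω ≤ u} ≤ Real.exp (-(S.card * q)) := by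
  have h := hi.measure_inter_preimage_eq_mul S (sets := fun _ => Set.Iic u)
    (fun i _ => measurableSet_Iic)
  have h1 : {ω | ∀ i ∈ S, X i ω ≤ u} = ⋂ i ∈ S, X i ⁻¹' Set.Iic u := by
    ext; simp
  rw [h1, measureReal_def, h, ENNReal.toReal_prod]
  calc ∏ i ∈ S, (μ (X i ⁻¹' Set.Iic u)).toReal ≤ ∏ i ∈ S, Real.exp (-q) := by
        refine Finset.prod_le_prod (fun _ _ => ENNReal.toReal_nonneg) fun i hiS => ?_
        have hc : X i ⁻¹' Set.Iic u = {ω | u < X i ω}ᶜ := by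
          ext; simp
        have hnm : NullMeasurableSet {ω | u < X i ω} μ :=
          (hm i).nullMeasurableSet_preimage measurableSet_Ioi
        rw [hc, ← measureReal_def, measureReal_compl₀ hnm, probReal_univ]
        have := Real.add_one_le_exp (-q)
        linarith [hq i hiS]
    _ = Real.exp (-(S.card * q)) := by
        rw [Finset.prod_const, ← Real.exp_nat_mul]; ring_nf

end Tails

/-! ### Roots of unity and their largest real part away from 1. -/

section RootsOfUnity

variable {k : ℕ}

lemma color_eq_pow (j : Fin k) : color k j = Complex.exp (2 * Real.pi * Complex.I / k) ^ (j : ℕ) := by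
  rw [color, ← Complex.exp_nat_mul]
  ring_nf

lemma color_pow_eq_one (j : Fin k) : color k j ^ k = 1 := by
  have hk : k ≠ 0 := j.pos.ne'
  rw [color_eq_pow, ← pow_mul, mul_comm (j : ℕ) k, pow_mul, (Complex.isPrimitiveRoot_exp k hk).pow_eq_one,
    one_pow]

lemma color_injective : Function.Injective (color k) := by
  intro i j h
  rw [color_eq_pow, color_eq_pow] at h
  exact Fin.ext ((Complex.isPrimitiveRoot_exp k i.pos.ne').pow_inj i.2 j.2 h)

lemma mem_range_color_iff (hk : k ≠ 0) (w : ℂ) : w ∈ Set.range (color k) ↔ w ^ k = 1 := by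
  constructor
  · rintro ⟨j, rfl⟩
    exact color_pow_eq_one j
  · intro h
    have : NeZero k := ⟨hk⟩
    obtain ⟨i, hi, rfl⟩ := (Complex.isPrimitiveRoot_exp k hk).eq_pow_of_pow_eq_one h
    exact ⟨⟨i, hi⟩, color_eq_pow _⟩

lemma norm_eq_one_of_mem_range_color {w : ℂ} (h : w ∈ Set.range (color k)) : ‖w‖ = 1 := by
  obtain ⟨j, rfl⟩ := h
  exact Complex.norm_eq_one_of_pow_eq_one (color_pow_eq_one j) j.pos.ne'

lemma Real.cos_two_pi_mul_div_le (hk : k ≠ 0) {j : ℕ} (hj : 1 ≤ j) (hjk : j < k) :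
    Real.cos (2 * Real.pi * j / k) ≤ Real.cos (2 * Real.pi / k) := by
  have hk0 : (0 : ℝ) < k := by positivity
  have hpi := Real.pi_pos
  have h1 : (1 : ℝ) ≤ j := by exact_mod_cast hj
  have h2 : (j : ℝ) + 1 ≤ k := by exact_mod_cast hjk
  rcases le_total (2 * j : ℝ) k with h | h
  · apply Real.cos_le_cos_of_nonneg_of_le_pi (by positivity)
    · rw [div_le_iff₀ hk0]; nlinarith
    · exact div_le_div_of_nonneg_right (by nlinarith) hk0.le
  -- Past the half circle, `j` is reflected to `k - j`.
  · rw [← Real.cos_two_pi_sub (2 * Real.pi * j / k)]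
    have : 2 * Real.pi - 2 * Real.pi * j / k = 2 * Real.pi * (k - j) / k := by
      field_simp
    rw [this]
    apply Real.cos_le_cos_of_nonneg_of_le_pi (by positivity)
    · rw [div_le_iff₀ hk0]; nlinarith
    · exact div_le_div_of_nonneg_right (by nlinarith) hk0.le

lemma re_le_cos_of_pow_eq_one (hk : k ≠ 0) {w : ℂ} (h : w ^ k = 1) (h1 : w ≠ 1) :
    w.re ≤ Real.cos (2 * Real.pi / k) := by
  have : NeZero k := ⟨hk⟩
  obtain ⟨j, hj, rfl⟩ := (Complex.isPrimitiveRoot_exp k hk).eq_pow_of_pow_eq_one h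
  have hj0 : 1 ≤ j := by
    rcases Nat.eq_zero_or_pos j with rfl | h0
    · simp at h1
    · exact h0
  rw [← Complex.exp_nat_mul]
  have : (j : ℂ) * (2 * Real.pi * Complex.I / k) = ((2 * Real.pi * j / k : ℝ) : ℂ) * Complex.I := by
    push_cast; ring
  rw [this, Complex.exp_ofReal_mul_I_re]
  exact Real.cos_two_pi_mul_div_le hk hj0 hj

lemma one_sub_cos_two_pi_div_pos (hk : 2 ≤ k) : 0 < 1 - Real.cos (2 * Real.pi / k) := by
  have hk0 : (2 : ℝ) ≤ k := by exact_mod_cast hk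
  have hpi := Real.pi_pos
  have : Real.cos (2 * Real.pi / k) < Real.cos 0 := by
    apply Real.cos_lt_cos_of_nonneg_of_le_pi le_rfl
    · rw [div_le_iff₀ (by linarith)]; nlinarith
    · positivity
  simpa using this

end RootsOfUnity

/-! ### The likelihood comparison and the signal gap. -/

section Overlap

variable {n : ℕ}

lemma phaseMatrix_isHermitian (x : Fin n → ℂ) : (phaseMatrix x).IsHermitian := by
  ext i j
  simp [phaseMatrix, Matrix.vecMulVec_apply, mul_comm]

/-- The loss `n ^ 2 - |⟨y, x⟩| ^ 2` of signal when `x` is used in place of `y`. -/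
noncomputable def signalGap (y x : Fin n → ℂ) : ℝ := (n : ℝ) ^ 2 - ‖∑ i, x i * star (y i)‖ ^ 2

lemma norm_sum_sq (z : Fin n → ℂ) : ‖∑ i, z i‖ ^ 2 = ∑ i, ∑ j, (z i * star (z j)).re := by
  rw [← Complex.normSq_eq_norm_sq]
  have : (Complex.normSq (∑ i, z i) : ℂ) = ∑ i, ∑ j, z i * star (z j) := by
    rw [← Complex.mul_conj, map_sum, Finset.sum_mul_sum]
    rfl
  have h := congrArg Complex.re this
  simpa using h

lemma frobPair_phaseMatrix (y x : Fin n → ℂ) :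
    frobPair (phaseMatrix y) (phaseMatrix x) = ‖∑ i, x i * star (y i)‖ ^ 2 := by
  rw [norm_sum_sq, frobPair]
  refine Finset.sum_congr rfl fun i _ => Finset.sum_congr rfl fun j _ => ?_
  congr 1
  simp [phaseMatrix, Matrix.vecMulVec_apply]
  ring

lemma frobSq_phaseMatrix {x : Fin n → ℂ} (hx : ∀ i, ‖x i‖ = 1) :
    frobSq (phaseMatrix x) = (n : ℝ) ^ 2 := by
  simp [frobSq, phaseMatrix, Matrix.vecMulVec_apply, hx, sq]

lemma frobSq_sub (A B : Matrix (Fin n) (Fin n) ℂ) :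
    frobSq (A - B) = frobSq A + frobSq B - 2 * frobPair A B := by
  rw [← frobPair_self, frobPair_sub, frobPair_comm _ A, frobPair_comm _ B, frobPair_sub,
    frobPair_sub, frobPair_self, frobPair_self, frobPair_comm B A]
  ring

lemma frobSq_phaseMatrix_sub {x y : Fin n → ℂ} (hx : ∀ i, ‖x i‖ = 1) (hy : ∀ i, ‖y i‖ = 1) :
    frobSq (phaseMatrix x - phaseMatrix y) = 2 * signalGap y x := by
  rw [frobSq_sub, frobSq_phaseMatrix hx, frobSq_phaseMatrix hy, frobPair_comm,
    frobPair_phaseMatrix, signalGap]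
  ring

lemma frobPair_observation_sub {x y : Fin n → ℂ} (hy : ∀ i, ‖y i‖ = 1)
    (σ : ℝ) (W : Matrix (Fin n) (Fin n) ℂ) :
    frobPair (observation y σ W) (phaseMatrix x) - frobPair (observation y σ W) (phaseMatrix y) =
      σ * frobPair W (phaseMatrix x - phaseMatrix y) - signalGap y x := by
  have h : ∀ A, frobPair (observation y σ W) A = frobPair (phaseMatrix y) A + σ * frobPair W A :=
    fun A => by
      rw [observation, frobPair_comm, frobPair_add, frobPair_smul, frobPair_comm A,
        frobPair_comm A]
  rw [h, h, frobPair_sub]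
  rw [frobPair_phaseMatrix, frobPair_self, frobSq_phaseMatrix hy, signalGap]
  ring

lemma frobSq_sub_phaseMatrix_le_iff {x z : Fin n → ℂ} (hx : ∀ i, ‖x i‖ = 1) (hz : ∀ i, ‖z i‖ = 1)
    (U : Matrix (Fin n) (Fin n) ℂ) :
    frobSq (U - phaseMatrix x) ≤ frobSq (U - phaseMatrix z) ↔
      frobPair U (phaseMatrix z) ≤ frobPair U (phaseMatrix x) := by
  rw [frobSq_sub, frobSq_sub, frobSq_phaseMatrix hx, frobSq_phaseMatrix hz]
  constructor <;> intro h <;> linarith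

lemma signalGap_eq_sum {x y : Fin n → ℂ} :
    signalGap y x =
      ∑ i, ∑ j, (1 - ((x i * star (y i)) * star (x j * star (y j))).re) := by
  rw [signalGap, norm_sum_sq]
  simp [Finset.sum_sub_distrib, sq]

variable {k : ℕ}

lemma norm_of_mem_balancedAssignments {x : Fin n → ℂ} (hx : x ∈ balancedAssignments n k) (i : Fin n) :
    ‖x i‖ = 1 := norm_eq_one_of_mem_range_color (hx.1 i)

lemma phaseMatrix_eq_of_mem_phaseClass {x y : Fin n → ℂ} (hx : x ∈ phaseClass k y) :
    phaseMatrix x = phaseMatrix y := by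
  obtain ⟨-, α, hα⟩ := hx
  ext i j
  have h : Complex.exp (Complex.I * α) * star (Complex.exp (Complex.I * α)) = 1 := by
    rw [Complex.star_def, Complex.mul_conj, Complex.normSq_eq_norm_sq, mul_comm,
      Complex.norm_exp_ofReal_mul_I]
    simp
  simp only [phaseMatrix, Matrix.vecMulVec_apply, Pi.star_apply, ← hα, star_mul']
  linear_combination (-(x i * star (x j))) * h

lemma mem_phaseClass_of_eq_mul {x y : Fin n → ℂ} (hx : x ∈ balancedAssignments n k) {w : ℂ}
    (hw : ‖w‖ = 1) (h : ∀ i, x i = w * y i) : x ∈ phaseClass k y := by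
  refine ⟨hx, -w.arg, fun i => ?_⟩
  have h1 : Complex.exp (w.arg * Complex.I) = w := by
    have := Complex.norm_mul_exp_arg_mul_I w
    rwa [hw, Complex.ofReal_one, one_mul] at this
  have h2 : Complex.exp (Complex.I * ((-w.arg : ℝ) : ℂ)) * w = 1 := by
    nth_rewrite 2 [← h1]
    rw [← Complex.exp_add]
    simp [mul_comm]
  rw [h, ← mul_assoc, h2, one_mul]

/-- With `z = x ȳ`, the gap is the sum of `1 - Re(z_i z̄_j)`. A term vanishes when `z_i = z_j`;
otherwise `z_i z̄_j` is a root of unity other than 1, and the term is at least `1 - cos(2π/k)`. -/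
lemma card_mul_le_signalGap (hk : 2 ≤ k) {x y : Fin n → ℂ} (hx : ∀ i, x i ∈ Set.range (color k))
    (hy : ∀ i, y i ∈ Set.range (color k)) :
    (1 - Real.cos (2 * Real.pi / k)) *
      ∑ i, (Finset.univ.filter fun j => x i * star (y i) ≠ x j * star (y j)).card ≤
      signalGap y x := by
  have hk0 : k ≠ 0 := by omega
  rw [signalGap_eq_sum]
  push_cast
  rw [Finset.mul_sum]
  refine Finset.sum_le_sum fun i _ => ?_
  rw [Finset.card_filter]
  push_cast
  rw [Finset.mul_sum]
  refine Finset.sum_le_sum fun j _ => ?_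
  have hz : ∀ i, ‖x i * star (y i)‖ = 1 := fun i => by
    rw [norm_mul, norm_star, norm_eq_one_of_mem_range_color (hx i),
      norm_eq_one_of_mem_range_color (hy i), one_mul]
  have hzk : ∀ i, (x i * star (y i)) ^ k = 1 := fun i => by
    rw [mul_pow, ← star_pow, (mem_range_color_iff hk0 _).1 (hx i),
      (mem_range_color_iff hk0 _).1 (hy i), star_one, one_mul]
  obtain ⟨a, ha⟩ : ∃ a, a = x i * star (y i) := ⟨_, rfl⟩
  obtain ⟨b, hb⟩ : ∃ b, b = x j * star (y j) := ⟨_, rfl⟩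
  have hak := ha ▸ hzk i
  have hbk := hb ▸ hzk j
  have hbn : ‖b‖ = 1 := hb ▸ hz j
  have hbb : b * star b = 1 := by
    rw [Complex.star_def, Complex.mul_conj, Complex.normSq_eq_norm_sq, hbn]
    simp
  rw [← ha, ← hb]
  by_cases hab : a = b
  · rw [hab, hbb]; simp
  · rw [if_pos hab, mul_one]
    have := re_le_cos_of_pow_eq_one hk0 (w := a * star b)
      (by rw [mul_pow, ← star_pow, hak, hbk, star_one, one_mul]) (fun h => hab (by
        linear_combination b * h - a * hbb))
    linarith

end Overlap

/-! ### Counting differing pairs and assignments. -/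

section Counting

/-- Every ordered pair with exactly one member in `{z = w}` is counted. -/
lemma two_mul_card_mul_le_sum_card {n : ℕ} (z : Fin n → ℂ) (w : ℂ) :
    2 * (Finset.univ.filter fun i => z i ≠ w).card *
      (n - (Finset.univ.filter fun i => z i ≠ w).card : ℝ) ≤
      ((∑ i, (Finset.univ.filter fun j => z i ≠ z j).card : ℕ) : ℝ) := by
  set S := Finset.univ.filter fun i => z i ≠ w with hS
  have hc : ((Finset.univ.filter fun i => z i = w).card : ℝ) = n - S.card := by
    have := Finset.card_filter_add_card_filter_not (s := (Finset.univ : Finset (Fin n)))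
      (fun i => z i = w)
    rw [Finset.card_univ, Fintype.card_fin] at this
    have h2 : ((Finset.univ.filter fun i => z i = w).card : ℝ) + S.card = n := by
      exact_mod_cast this
    linarith
  rw [← Finset.sum_filter_add_sum_filter_not Finset.univ (fun i => z i = w)]
  push_cast
  have h1 : ∑ i with z i = w, (S.card : ℝ) ≤
      ∑ i with z i = w, ((Finset.univ.filter fun j => z i ≠ z j).card : ℝ) := by
    refine Finset.sum_le_sum fun i hi => ?_
    rw [Finset.mem_filter] at hi
    exact_mod_cast Finset.card_le_card fun j hj => by
      simp only [hS, Finset.mem_filter, Finset.mem_univ, true_and] at hj ⊢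
      rw [hi.2]; exact Ne.symm hj
  have h2 : ∑ i with ¬ z i = w, (n - S.card : ℝ) ≤
      ∑ i with ¬ z i = w, ((Finset.univ.filter fun j => z i ≠ z j).card : ℝ) := by
    refine Finset.sum_le_sum fun i hi => ?_
    rw [← hc]
    rw [Finset.mem_filter] at hi
    exact_mod_cast Finset.card_le_card fun j hj => by
      simp only [Finset.mem_filter, Finset.mem_univ, true_and] at hj ⊢
      rw [hj]; exact hi.2
  rw [Finset.sum_const, nsmul_eq_mul, hc] at h1
  rw [Finset.sum_const, nsmul_eq_mul] at h2
  have h3 : ((Finset.univ.filter fun i => ¬ z i = w).card : ℝ) = S.card := rfl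
  rw [h3] at h2
  linarith

/-- The summand is a product over coordinates, so the sum factorizes. -/
lemma sum_piFinset_pow_card_ne {n : ℕ} (R : Finset ℂ) (w : Fin n → ℂ) (hw : ∀ i, w i ∈ R) (p : ℝ) :
    ∑ x ∈ Fintype.piFinset (fun _ : Fin n => R), p ^ (Finset.univ.filter fun i => x i ≠ w i).card =
      (1 + (R.card - 1) * p) ^ n := by
  have h : ∀ i : Fin n, ∑ v ∈ R, (if v ≠ w i then p else 1) = 1 + (R.card - 1) * p := by
    intro i
    rw [← Finset.add_sum_erase R _ (hw i), Finset.sum_congr rfl (g := fun _ => p)]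
    · rw [Finset.sum_const, Finset.card_erase_of_mem (hw i), nsmul_eq_mul,
        Nat.cast_sub (Finset.card_pos.2 ⟨_, hw i⟩)]
      simp
    · intro v hv
      rw [if_pos (Finset.ne_of_mem_erase hv)]
  calc _ = ∑ x ∈ Fintype.piFinset (fun _ : Fin n => R), ∏ i, (if x i ≠ w i then p else 1) := by
        refine Finset.sum_congr rfl fun x _ => ?_
        rw [Finset.prod_ite, Finset.prod_const, Finset.prod_const_one, mul_one]
    _ = ∏ i : Fin n, ∑ v ∈ R, (if v ≠ w i then p else 1) := by
        rw [Finset.prod_univ_sum]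
    _ = _ := by
        rw [Finset.prod_congr rfl (fun i _ => h i), Finset.prod_const, Finset.card_univ,
          Fintype.card_fin]

end Counting

/-! ### The union bound over wrong assignments. -/

section UnionBound

variable {n k : ℕ}

/-- The `k`-th roots of unity as a finite set. -/
noncomputable def colorFinset (k : ℕ) : Finset ℂ := Finset.univ.image (color k)

lemma mem_colorFinset {w : ℂ} : w ∈ colorFinset k ↔ w ∈ Set.range (color k) := by
  simp [colorFinset]

lemma card_colorFinset : (colorFinset k).card = k := by
  rw [colorFinset, Finset.card_image_of_injective _ color_injective, Finset.card_univ,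
    Fintype.card_fin]

/-- The sum over `w` covers the case where `x` is near some rotation `w • y`, the last exponential
the case where it is far from all of them. The indicator is zero here; it is carried along so that
the later sum over all `x` omits `x = w • y`. -/
lemma exp_neg_signalGap_le (hk : 2 ≤ k) {x y : Fin n → ℂ} (hx : ∀ i, x i ∈ colorFinset k)
    (hy : ∀ i, y i ∈ colorFinset k) (hxy : ∀ w ∈ colorFinset k, x ≠ w • y)
    {ε s : ℝ} (hs : 0 < s) :
    Real.exp (-(signalGap y x / (4 * s))) ≤
      ∑ w ∈ colorFinset k,
        (Real.exp (-((1 - Real.cos (2 * Real.pi / k)) * (1 - ε) * n / (2 * s))) ^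
          (Finset.univ.filter fun i => x i ≠ (w • y) i).card - if x = w • y then 1 else 0) +
      Real.exp (-((1 - Real.cos (2 * Real.pi / k)) * ε * n ^ 2 / (4 * s))) := by
  have hk0 : k ≠ 0 := by omega
  set β := 1 - Real.cos (2 * Real.pi / k) with hβ
  have hβ0 : 0 < β := one_sub_cos_two_pi_div_pos hk
  set p := Real.exp (-(β * (1 - ε) * n / (2 * s))) with hp
  have hgap := card_mul_le_signalGap hk (fun i => mem_colorFinset.1 (hx i))
    (fun i => mem_colorFinset.1 (hy i))
  rw [← hβ] at hgap
  have hyy : ∀ i, y i * star (y i) = 1 := fun i => by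
    rw [Complex.star_def, Complex.mul_conj, Complex.normSq_eq_norm_sq,
      norm_eq_one_of_mem_range_color (mem_colorFinset.1 (hy i))]
    simp
  have hiff : ∀ w i, x i * star (y i) ≠ w ↔ x i ≠ (w • y) i := by
    intro w i
    rw [Pi.smul_apply, smul_eq_mul, not_iff_not]
    constructor
    · rintro rfl; linear_combination -(x i) * hyy i
    · intro h; linear_combination star (y i) * h + w * hyy i
  have hnn : ∀ w ∈ colorFinset k, 0 ≤ p ^ (Finset.univ.filter fun i => x i ≠ (w • y) i).card -
      if x = w • y then 1 else 0 := by
    intro w hw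
    rw [if_neg (hxy w hw), sub_zero]
    positivity
  by_cases h : ∃ w ∈ colorFinset k, ((Finset.univ.filter fun i => x i ≠ (w • y) i).card : ℝ) ≤ ε * n
  · obtain ⟨w, hw, hle⟩ := h
    refine le_trans ?_ (le_add_of_le_of_nonneg (Finset.single_le_sum hnn hw) (Real.exp_pos _).le)
    rw [if_neg (hxy w hw), sub_zero, hp, ← Real.exp_nat_mul, Real.exp_le_exp]
    have h2 := two_mul_card_mul_le_sum_card (fun i => x i * star (y i)) w
    have hcard : (Finset.univ.filter fun i => x i * star (y i) ≠ w) =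
        Finset.univ.filter fun i => x i ≠ (w • y) i := Finset.filter_congr fun i _ => hiff w i
    rw [hcard] at h2
    set l : ℝ := ((Finset.univ.filter fun i => x i ≠ (w • y) i).card : ℝ) with hl
    have hl0 : 0 ≤ l := by positivity
    have h3 : β * (2 * l * ((1 - ε) * n)) ≤ signalGap y x := by
      refine le_trans ?_ hgap
      refine mul_le_mul_of_nonneg_left (le_trans ?_ h2) hβ0.le
      exact mul_le_mul_of_nonneg_left (by linarith) (by positivity)
    rw [mul_neg, neg_le_neg_iff, ← mul_div_assoc, div_le_div_iff₀ (by positivity) (by positivity)]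
    nlinarith
  · push Not at h
    refine le_trans ?_ (le_add_of_nonneg_left (Finset.sum_nonneg hnn))
    rw [Real.exp_le_exp, neg_le_neg_iff]
    gcongr
    refine le_trans ?_ hgap
    rw [mul_assoc]
    refine mul_le_mul_of_nonneg_left ?_ hβ0.le
    push_cast
    calc ε * (n : ℝ) ^ 2 = ∑ i : Fin n, ε * n := by
          rw [Finset.sum_const, Finset.card_univ, Fintype.card_fin, nsmul_eq_mul]; ring
      _ ≤ _ := Finset.sum_le_sum fun i _ => ?_
    -- Being far from the rotation by `w = x i * star (y i)` says that more than `ε n` indices `j`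
    -- differ from this `i`.
    have hm : x i * star (y i) ∈ colorFinset k := by
      rw [mem_colorFinset, mem_range_color_iff hk0, mul_pow, ← star_pow,
        (mem_range_color_iff hk0 _).1 (mem_colorFinset.1 (hx i)),
        (mem_range_color_iff hk0 _).1 (mem_colorFinset.1 (hy i)), star_one, one_mul]
    refine (h _ hm).le.trans (le_of_eq ?_)
    congr 2
    ext j
    simp only [Finset.mem_filter, Finset.mem_univ, true_and, ← hiff]
    exact ne_comm

lemma sum_exp_neg_signalGap_le (hk : 2 ≤ k) {y : Fin n → ℂ} (hy : ∀ i, y i ∈ colorFinset k)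
    {ε s : ℝ} (hs : 0 < s) (B : Finset (Fin n → ℂ))
    (hB : ∀ x ∈ B, (∀ i, x i ∈ colorFinset k) ∧ ∀ w ∈ colorFinset k, x ≠ w • y) :
    ∑ x ∈ B, Real.exp (-(signalGap y x / (4 * s))) ≤
      k * ((1 + (k - 1) *
        Real.exp (-((1 - Real.cos (2 * Real.pi / k)) * (1 - ε) * n / (2 * s)))) ^ n - 1) +
      k ^ n * Real.exp (-((1 - Real.cos (2 * Real.pi / k)) * ε * n ^ 2 / (4 * s))) := by
  classical
  set β := 1 - Real.cos (2 * Real.pi / k) with hβ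
  set p := Real.exp (-(β * (1 - ε) * n / (2 * s))) with hp
  set e := Real.exp (-(β * ε * n ^ 2 / (4 * s))) with he
  have hk0 : k ≠ 0 := by omega
  have hBA : B ⊆ Fintype.piFinset (fun _ : Fin n => colorFinset k) := fun x hx =>
    Fintype.mem_piFinset.2 (hB x hx).1
  have hwy : ∀ w ∈ colorFinset k, ∀ i, (w • y) i ∈ colorFinset k := by
    intro w hw i
    rw [mem_colorFinset, mem_range_color_iff hk0, Pi.smul_apply, smul_eq_mul, mul_pow,
      (mem_range_color_iff hk0 _).1 (mem_colorFinset.1 hw),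
      (mem_range_color_iff hk0 _).1 (mem_colorFinset.1 (hy i)), one_mul]
  calc ∑ x ∈ B, Real.exp (-(signalGap y x / (4 * s)))
      ≤ ∑ x ∈ B, (∑ w ∈ colorFinset k,
        (p ^ (Finset.univ.filter fun i => x i ≠ (w • y) i).card - if x = w • y then 1 else 0) + e) :=
        Finset.sum_le_sum fun x hx => exp_neg_signalGap_le hk (hB x hx).1 hy (hB x hx).2 hs
    _ ≤ ∑ x ∈ Fintype.piFinset (fun _ : Fin n => colorFinset k), (∑ w ∈ colorFinset k,
        (p ^ (Finset.univ.filter fun i => x i ≠ (w • y) i).card -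
          if x = w • y then 1 else 0) + e) := by
        -- Enlarging `B` to all colorings is harmless: at `x = w • y` the bracket is `1 - 1 = 0`,
        -- and elsewhere it is positive.
        refine Finset.sum_le_sum_of_subset_of_nonneg hBA fun x _ _ => ?_
        refine add_nonneg (Finset.sum_nonneg fun w _ => ?_) (Real.exp_pos _).le
        split_ifs with h
        · simp [h]
        · rw [sub_zero]; positivity
    _ = _ := by
        rw [Finset.sum_add_distrib, Finset.sum_comm, Finset.sum_const, Fintype.card_piFinset_const,
          card_colorFinset, nsmul_eq_mul, Nat.cast_pow]
        congr 1
        rw [Finset.sum_congr rfl (g := fun _ => (1 + (k - 1) * p) ^ n - 1)]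
        · rw [Finset.sum_const, card_colorFinset, nsmul_eq_mul]
        · intro w hw
          rw [Finset.sum_sub_distrib, sum_piFinset_pow_card_ne _ _ (hwy w hw), card_colorFinset,
            Finset.sum_ite_eq', if_pos (Fintype.mem_piFinset.2 (hwy w hw))]

variable {Ω : Type*} [MeasurableSpace Ω] {μ : Measure Ω} [IsProbabilityMeasure μ]
  {W : Ω → Matrix (Fin n) (Fin n) ℂ}

lemma signalGap_nonneg {x y : Fin n → ℂ} (hx : ∀ i, ‖x i‖ = 1) (hy : ∀ i, ‖y i‖ = 1) :
    0 ≤ signalGap y x := by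
  have := frobSq_nonneg (phaseMatrix x - phaseMatrix y)
  rw [frobSq_phaseMatrix_sub hx hy] at this
  linarith

lemma IsGUE.measureReal_signalGap_le (hW : IsGUE μ W) {x y : Fin n → ℂ} (hx : ∀ i, ‖x i‖ = 1)
    (hy : ∀ i, ‖y i‖ = 1) {σ s : ℝ} (hs : 0 < s) (hσ : σ ^ 2 ≤ s) :
    μ.real {ω | signalGap y x ≤ σ * frobPair (W ω) (phaseMatrix x - phaseMatrix y)} ≤
      Real.exp (-(signalGap y x / (4 * s))) := by
  have hD := signalGap_nonneg hx hy
  have hlaw := gaussianReal_const_mul (hW.hasLaw_frobPair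
    ((phaseMatrix_isHermitian x).sub (phaseMatrix_isHermitian y))) σ
  rw [mul_zero, frobSq_phaseMatrix_sub hx hy] at hlaw
  -- The optimal Chernoff parameter is `1 / (2σ²)`; using `s ≥ σ²` in place of `σ²` also covers `σ =
  -- 0`.
  refine (measureReal_ge_le_exp_of_hasLaw_gaussianReal hlaw (signalGap y x)
    (t := 1 / (2 * s)) (by positivity)).trans ?_
  rw [Real.exp_le_exp]
  simp only [NNReal.coe_mul, NNReal.coe_mk, Real.coe_toNNReal _ (mul_nonneg two_pos.le hD)]
  generalize signalGap y x = D at *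
  have h1 : -(1 / (2 * s)) * D + σ ^ 2 * (2 * D) * (1 / (2 * s)) ^ 2 / 2 =
      -(2 * s * D - σ ^ 2 * D) / (4 * s ^ 2) := by field_simp; ring
  have h2 : -(D / (4 * s)) = -(s * D) / (4 * s ^ 2) := by field_simp
  rw [h1, h2]
  gcongr
  nlinarith

/-- Union bound for the probability that the maximum likelihood estimator fails. -/
theorem IsGUE.measureReal_exists_signalGap_le (hk : 2 ≤ k) (hW : IsGUE μ W) {y : Fin n → ℂ}
    (hy : y ∈ balancedAssignments n k) {σ s : ℝ} (ε : ℝ) (hs : 0 < s) (hσ : σ ^ 2 ≤ s) :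
    μ.real {ω | ∃ x ∈ balancedAssignments n k, x ∉ phaseClass k y ∧
        signalGap y x ≤ σ * frobPair (W ω) (phaseMatrix x - phaseMatrix y)} ≤
      k * ((1 + (k - 1) *
        Real.exp (-((1 - Real.cos (2 * Real.pi / k)) * (1 - ε) * n / (2 * s)))) ^ n - 1) +
      k ^ n * Real.exp (-((1 - Real.cos (2 * Real.pi / k)) * ε * n ^ 2 / (4 * s))) := by
  classical
  let B := (Fintype.piFinset (fun _ : Fin n => colorFinset k)).filter
    fun x => x ∈ balancedAssignments n k ∧ x ∉ phaseClass k y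
  have hB : ∀ x ∈ B, (∀ i, x i ∈ colorFinset k) ∧ ∀ w ∈ colorFinset k, x ≠ w • y := by
    intro x hx
    simp only [B, Finset.mem_filter, Fintype.mem_piFinset] at hx
    refine ⟨hx.1, fun w hw h => hx.2.2 ?_⟩
    exact mem_phaseClass_of_eq_mul hx.2.1 (norm_eq_one_of_mem_range_color (mem_colorFinset.1 hw))
      fun i => by rw [h]; rfl
  refine le_trans ?_ (sum_exp_neg_signalGap_le hk (fun i => mem_colorFinset.2 (hy.1 i)) hs B hB)
  have hsub : {ω | ∃ x ∈ balancedAssignments n k, x ∉ phaseClass k y ∧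
        signalGap y x ≤ σ * frobPair (W ω) (phaseMatrix x - phaseMatrix y)} ⊆
      ⋃ x ∈ B, {ω | signalGap y x ≤ σ * frobPair (W ω) (phaseMatrix x - phaseMatrix y)} := by
    rintro ω ⟨x, hx, hxy, h⟩
    simp only [Set.mem_iUnion]
    refine ⟨x, ?_, h⟩
    simp only [B, Finset.mem_filter, Fintype.mem_piFinset]
    exact ⟨fun i => mem_colorFinset.2 (hx.1 i), hx, hxy⟩
  refine (measureReal_mono hsub (measure_ne_top _ _)).trans ((measureReal_biUnion_finset_le _ _).trans ?_)
  refine Finset.sum_le_sum fun x hx => ?_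
  exact hW.measureReal_signalGap_le
    (fun i => norm_eq_one_of_mem_range_color (mem_colorFinset.1 ((hB x hx).1 i)))
    (norm_of_mem_balancedAssignments hy) hs hσ

end UnionBound

/-! ### Exact recovery below the critical variance. -/

section Subcritical

lemma criticalVariance_pos {n k : ℕ} (hk : 2 ≤ k) (hn : 2 ≤ n) : 0 < criticalVariance n k := by
  have h1 := one_sub_cos_two_pi_div_pos hk
  have h2 : (2 : ℝ) ≤ n := by exact_mod_cast hn
  have h3 : 0 < Real.log n := Real.log_pos (by linarith)
  unfold criticalVariance
  positivity

lemma tendsto_log_natCast_mul_atTop {k : ℕ} (hk : 2 ≤ k) :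
    Tendsto (fun m : ℕ => Real.log ((k * m : ℕ) : ℝ)) atTop atTop :=
  Real.tendsto_log_atTop.comp (tendsto_natCast_atTop_atTop.comp
    (tendsto_id.const_mul_atTop' (by omega)))

/-- The union bound at `s = (1 - δ) * criticalVariance n k`, in closed form. -/
lemma unionBound_le {n k : ℕ} (hk : 2 ≤ k) (hn : 2 ≤ n) {δ s : ℝ} (hδ : 0 < δ) (hδ1 : δ < 1)
    (hs : s = (1 - δ) * criticalVariance n k) :
    k * ((1 + (k - 1) *
        Real.exp (-((1 - Real.cos (2 * Real.pi / k)) * (1 - δ / 2) * n / (2 * s)))) ^ n - 1) +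
      k ^ n * Real.exp (-((1 - Real.cos (2 * Real.pi / k)) * (δ / 2) * n ^ 2 / (4 * s))) ≤
    k * (Real.exp (k * Real.exp (-(δ / 2) * Real.log n)) - 1) +
      Real.exp (n * (Real.log k - δ / 4 * Real.log n)) := by
  have hβ := one_sub_cos_two_pi_div_pos hk
  unfold criticalVariance at hs
  set β := 1 - Real.cos (2 * Real.pi / k)
  have hn' : (2 : ℝ) ≤ n := by exact_mod_cast hn
  have hk' : (2 : ℝ) ≤ k := by exact_mod_cast hk
  have hL : 0 < Real.log n := Real.log_pos (by linarith)
  have hd : 0 < 1 - δ := by linarith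
  have hn0 : (0 : ℝ) < n := by linarith
  have e1 : β * (1 - δ / 2) * n / (2 * s) = (1 - δ / 2) / (1 - δ) * Real.log n := by
    rw [hs]; field_simp
  have e2 : β * (δ / 2) * n ^ 2 / (4 * s) = n * (δ / (4 * (1 - δ)) * Real.log n) := by
    rw [hs]; field_simp
  rw [e1, e2]
  -- The exponent `(1 - δ/2)/(1 - δ)` is at least `1 + δ/2`, so `n p ≤ n^(-δ/2)`, which tends to 0.
  have hp : Real.exp (-((1 - δ / 2) / (1 - δ) * Real.log n)) ≤
      Real.exp (-(δ / 2) * Real.log n) / n := by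
    rw [le_div_iff₀ hn0]
    nth_rewrite 2 [← Real.exp_log hn0]
    rw [← Real.exp_add, Real.exp_le_exp]
    have : 1 + δ / 2 ≤ (1 - δ / 2) / (1 - δ) := by
      rw [le_div_iff₀ hd]; nlinarith
    nlinarith
  refine add_le_add ?_ ?_
  · refine mul_le_mul_of_nonneg_left ?_ (by positivity)
    refine sub_le_sub_right ?_ _
    set p := Real.exp (-((1 - δ / 2) / (1 - δ) * Real.log n))
    have hp0 : 0 < p := Real.exp_pos _
    calc (1 + (k - 1) * p) ^ n ≤ (Real.exp (k * p)) ^ n := by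
          refine pow_le_pow_left₀ (by nlinarith) ?_ _
          have := Real.add_one_le_exp (k * p)
          nlinarith
      _ = Real.exp (k * (n * p)) := by rw [← Real.exp_nat_mul]; ring_nf
      _ ≤ _ := by
          rw [Real.exp_le_exp]
          refine mul_le_mul_of_nonneg_left ?_ (by positivity)
          rw [le_div_iff₀ hn0] at hp
          linarith
  · have : (k : ℝ) ^ n = Real.exp (n * Real.log k) := by
      rw [Real.exp_nat_mul, Real.exp_log (by linarith)]
    rw [this, ← Real.exp_add, Real.exp_le_exp, mul_sub (n : ℝ)]
    have h4 : δ / 4 ≤ δ / (4 * (1 - δ)) := by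
      rw [div_le_div_iff₀ (by norm_num) (by positivity)]; nlinarith
    have h5 : δ / 4 * Real.log n ≤ δ / (4 * (1 - δ)) * Real.log n := by gcongr
    have h6 := mul_le_mul_of_nonneg_left h5 hn0.le
    linarith

lemma tendsto_unionBound {k : ℕ} (hk : 2 ≤ k) {δ : ℝ} (hδ : 0 < δ) :
    Tendsto (fun m : ℕ => k * (Real.exp (k * Real.exp (-(δ / 2) * Real.log ((k * m : ℕ) : ℝ))) - 1) +
      Real.exp (((k * m : ℕ) : ℝ) * (Real.log k - δ / 4 * Real.log ((k * m : ℕ) : ℝ))))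
      atTop (𝓝 0) := by
  have hL := tendsto_log_natCast_mul_atTop hk
  have hn : Tendsto (fun m : ℕ => ((k * m : ℕ) : ℝ)) atTop atTop :=
    tendsto_natCast_atTop_atTop.comp (tendsto_id.const_mul_atTop' (by omega))
  have h1 : Tendsto (fun m : ℕ => Real.exp (-(δ / 2) * Real.log ((k * m : ℕ) : ℝ))) atTop (𝓝 0) :=
    Real.tendsto_exp_atBot.comp (hL.const_mul_atTop_of_neg (by linarith))
  have h2 : Tendsto (fun m : ℕ =>
      (k : ℝ) * (Real.exp (k * Real.exp (-(δ / 2) * Real.log ((k * m : ℕ) : ℝ))) - 1))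
      atTop (𝓝 (k * (Real.exp (k * 0) - 1))) :=
    (((Real.continuous_exp.tendsto _).comp (h1.const_mul (k : ℝ))).sub_const 1).const_mul _
  have h3 : Tendsto (fun m : ℕ => Real.log k - δ / 4 * Real.log ((k * m : ℕ) : ℝ)) atTop atBot := by
    have := tendsto_atBot_add_const_left atTop (Real.log k)
      (hL.const_mul_atTop_of_neg (show -(δ / 4) < 0 by linarith))
    refine this.congr fun m => by ring
  have h4 := Real.tendsto_exp_atBot.comp (hn.atTop_mul_atBot₀ h3)
  have := h2.add h4
  simpa using this

lemma exists_signalGap_le_of_notMem_phaseClass {n k : ℕ} {y : Fin n → ℂ} (hy : y ∈ balancedAssignments n k)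
    {yhat : Matrix (Fin n) (Fin n) ℂ → Fin n → ℂ} (hyhat : IsMLE k yhat) (σ : ℝ)
    (W : Matrix (Fin n) (Fin n) ℂ) (h : yhat (observation y σ W) ∉ phaseClass k y) :
    ∃ x ∈ balancedAssignments n k, x ∉ phaseClass k y ∧
      signalGap y x ≤ σ * frobPair W (phaseMatrix x - phaseMatrix y) := by
  obtain ⟨h1, h2⟩ := hyhat (observation y σ W)
  refine ⟨_, h1, h, ?_⟩
  have h3 := (frobSq_sub_phaseMatrix_le_iff (norm_of_mem_balancedAssignments h1)
    (norm_of_mem_balancedAssignments hy) _).1 (h2 y hy)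
  have h4 := frobPair_observation_sub (x := yhat (observation y σ W))
    (norm_of_mem_balancedAssignments hy) σ W
  linarith

/-- Below the critical variance the maximum likelihood estimator recovers the true assignment. -/
theorem tendsto_measure_mle_mem_one {k : ℕ} (hk : 2 ≤ k)
    {Ω : ℕ → Type*} [∀ m, MeasurableSpace (Ω m)]
    (μ : ∀ m, Measure (Ω m)) [∀ m, IsProbabilityMeasure (μ m)]
    (y : ∀ m, Fin (k * m) → ℂ) (hy : ∀ m, y m ∈ balancedAssignments (k * m) k)
    (W : ∀ m, Ω m → Matrix (Fin (k * m)) (Fin (k * m)) ℂ) (hW : ∀ m, IsGUE (μ m) (W m))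
    (yhat : ∀ m, Matrix (Fin (k * m)) (Fin (k * m)) ℂ → Fin (k * m) → ℂ)
    (hyhat : ∀ m, IsMLE k (yhat m)) (σ : ℕ → ℝ) {δ : ℝ} (hδ : 0 < δ)
    (hσ : ∀ᶠ m in atTop, σ m ^ 2 < (1 - δ) * criticalVariance (k * m) k) :
    Tendsto (fun m => μ m {ω | yhat m (observation (y m) (σ m) (W m ω)) ∈ phaseClass k (y m)})
      atTop (𝓝 1) := by
  have hlim : Tendsto (fun m : ℕ => 1 - ENNReal.ofReal
      (k * (Real.exp (k * Real.exp (-(δ / 2) * Real.log ((k * m : ℕ) : ℝ))) - 1) +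
      Real.exp (((k * m : ℕ) : ℝ) * (Real.log k - δ / 4 * Real.log ((k * m : ℕ) : ℝ)))))
      atTop (𝓝 1) := by
    have := ENNReal.Tendsto.sub (tendsto_const_nhds (x := (1 : ENNReal)))
      (ENNReal.tendsto_ofReal (tendsto_unionBound hk hδ)) (Or.inl ENNReal.one_ne_top)
    simpa using this
  refine tendsto_of_tendsto_of_tendsto_of_le_of_le' hlim tendsto_const_nhds ?_
    (Eventually.of_forall fun m => prob_le_one)
  filter_upwards [hσ, eventually_ge_atTop 1] with m hm hm1
  have hn : 2 ≤ k * m := by nlinarith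
  have hc := criticalVariance_pos hk hn
  -- Nonnegativity of `σ²` forces `1 - δ > 0`.
  have hδ1 : δ < 1 := by
    by_contra! h
    nlinarith [sq_nonneg (σ m)]
  have hs : 0 < (1 - δ) * criticalVariance (k * m) k := mul_pos (by linarith) hc
  have hU := (hW m).measureReal_exists_signalGap_le hk (hy m) (δ / 2) hs hm.le
  have hb := hU.trans (unionBound_le hk hn hδ hδ1 rfl)
  rw [tsub_le_iff_right]
  set G := {ω | yhat m (observation (y m) (σ m) (W m ω)) ∈ phaseClass k (y m)}
  set B := {ω | ∃ x ∈ balancedAssignments (k * m) k, x ∉ phaseClass k (y m) ∧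
        signalGap (y m) x ≤ σ m * frobPair (W m ω) (phaseMatrix x - phaseMatrix (y m))}
  -- The estimator is arbitrary, so `G` may be non-measurable; covering and subadditivity replace
  -- complements.
  have hcover : Set.univ ⊆ G ∪ B := by
    intro ω _
    by_cases h : ω ∈ G
    · exact Or.inl h
    · exact Or.inr (exists_signalGap_le_of_notMem_phaseClass (hy m) (hyhat m) (σ m) (W m ω) h)
  calc (1 : ENNReal) = μ m Set.univ := measure_univ.symm
    _ ≤ μ m (G ∪ B) := measure_mono hcover
    _ ≤ μ m G + μ m B := measure_union_le _ _
    _ ≤ _ := by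
      gcongr
      rw [← ofReal_measureReal]
      exact ENNReal.ofReal_le_ofReal hb

end Subcritical

/-! ### Rank-one matrices and the expansion of `P(y + v) - P(y)`. -/

section RankOne

variable {n : ℕ}

lemma frobPair_vecMulVec (p q r s : Fin n → ℂ) :
    frobPair (Matrix.vecMulVec p (star q)) (Matrix.vecMulVec r (star s)) =
      ((∑ i, star (p i) * r i) * ∑ j, q j * star (s j)).re := by
  rw [Finset.sum_mul_sum, Complex.re_sum, frobPair]
  refine Finset.sum_congr rfl fun i _ => ?_
  rw [Complex.re_sum]
  refine Finset.sum_congr rfl fun j _ => ?_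
  congr 1
  simp [Matrix.vecMulVec_apply]
  ring

lemma frobPair_add_left (U V A : Matrix (Fin n) (Fin n) ℂ) :
    frobPair (U + V) A = frobPair U A + frobPair V A := by
  rw [frobPair_comm, frobPair_add, frobPair_comm A, frobPair_comm A]

lemma frobSq_vecMulVec (p q : Fin n → ℂ) :
    frobSq (Matrix.vecMulVec p (star q)) = (∑ i, ‖p i‖ ^ 2) * ∑ j, ‖q j‖ ^ 2 := by
  rw [frobSq, Finset.sum_mul_sum]
  refine Finset.sum_congr rfl fun i _ => Finset.sum_congr rfl fun j _ => ?_
  simp [Matrix.vecMulVec_apply, mul_pow]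

lemma frobSq_add_le (A B : Matrix (Fin n) (Fin n) ℂ) :
    frobSq (A + B) ≤ 2 * frobSq A + 2 * frobSq B := by
  simp only [frobSq, Finset.mul_sum, ← Finset.sum_add_distrib]
  refine Finset.sum_le_sum fun i _ => Finset.sum_le_sum fun j _ => ?_
  rw [Matrix.add_apply]
  have h1 := norm_add_le (A i j) (B i j)
  have h2 := norm_nonneg (A i j + B i j)
  nlinarith [sq_nonneg (‖A i j‖ - ‖B i j‖)]

/-- The Hermitian matrix `v wᴴ + w vᴴ`. -/
def symmOuter (v w : Fin n → ℂ) : Matrix (Fin n) (Fin n) ℂ :=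
  Matrix.vecMulVec v (star w) + Matrix.vecMulVec w (star v)

lemma symmOuter_isHermitian (v w : Fin n → ℂ) : (symmOuter v w).IsHermitian := by
  ext i j
  simp [symmOuter, Matrix.vecMulVec_apply]
  ring

lemma symmOuter_add_left (v v' w : Fin n → ℂ) :
    symmOuter (v + v') w = symmOuter v w + symmOuter v' w := by
  ext i j
  simp [symmOuter, Matrix.vecMulVec_apply]
  ring

lemma symmOuter_add_right (v w w' : Fin n → ℂ) :
    symmOuter v (w + w') = symmOuter v w + symmOuter v w' := by
  ext i j
  simp [symmOuter, Matrix.vecMulVec_apply]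
  ring

lemma phaseMatrix_add_sub (y v : Fin n → ℂ) :
    phaseMatrix (y + v) - phaseMatrix y = symmOuter v y + phaseMatrix v := by
  ext i j
  simp [symmOuter, phaseMatrix, Matrix.vecMulVec_apply]
  ring

/-- Since `w` vanishes on `H`, each coordinate vector there is orthogonal to `w` and to the others,
so every cross term is zero. This orthogonality is why `y` gets truncated off `H`. -/
lemma frobPair_symmOuter_single (H : Finset (Fin n)) (w : Fin n → ℂ) (hw : ∀ i ∈ H, w i = 0)
    {a b : Fin n} (ha : a ∈ H) (hb : b ∈ H) (hab : a ≠ b) (u u' : ℂ) :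
    frobPair (symmOuter (Pi.single a u) w) (symmOuter (Pi.single b u') w) = 0 := by
  have h1 : ∑ i, star ((Pi.single a u : Fin n → ℂ) i) * w i = 0 := by
    rw [Finset.sum_eq_single a] <;> simp +contextual [hw a ha]
  have h2 : ∑ i, star ((Pi.single a u : Fin n → ℂ) i) * (Pi.single b u' : Fin n → ℂ) i = 0 := by
    rw [Finset.sum_eq_single a] <;> simp +contextual [hab]
  have h3 : ∑ i, (Pi.single a u : Fin n → ℂ) i * star ((Pi.single b u' : Fin n → ℂ) i) = 0 := by
    rw [Finset.sum_eq_single a] <;> simp +contextual [hab]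
  have h4 : ∑ i, star (w i) * (Pi.single b u' : Fin n → ℂ) i = 0 := by
    rw [Finset.sum_eq_single b] <;> simp +contextual [hw b hb]
  simp only [symmOuter, frobPair_add, frobPair_add_left, frobPair_vecMulVec]
  rw [h1, h2, h3, h4]
  simp

lemma frobSq_symmOuter_single (w : Fin n → ℂ) {a : Fin n} (ha : w a = 0) (u : ℂ) :
    frobSq (symmOuter (Pi.single a u) w) = 2 * ‖u‖ ^ 2 * ∑ i, ‖w i‖ ^ 2 := by
  rw [symmOuter, ← frobPair_self]
  simp only [frobPair_add, frobPair_add_left]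
  rw [frobPair_self, frobPair_self, frobSq_vecMulVec, frobSq_vecMulVec,
    frobPair_vecMulVec, frobPair_vecMulVec]
  have h1 : ∑ i, ‖(Pi.single a u : Fin n → ℂ) i‖ ^ 2 = ‖u‖ ^ 2 := by
    rw [Finset.sum_eq_single a] <;> simp +contextual
  have h2 : ∑ i, star ((Pi.single a u : Fin n → ℂ) i) * w i = 0 := by
    rw [Finset.sum_eq_single a] <;> simp +contextual [ha]
  have h3 : ∑ i, star (w i) * (Pi.single a u : Fin n → ℂ) i = 0 := by
    rw [Finset.sum_eq_single a] <;> simp +contextual [ha]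
  rw [h1, h2, h3]
  simp
  ring

end RankOne

/-! ### Swapping two vertices. -/

section Swap

variable {n k : ℕ}

lemma comp_swap_mem_balancedAssignments {y : Fin n → ℂ} (hy : y ∈ balancedAssignments n k)
    (e : Equiv.Perm (Fin n)) : y ∘ e ∈ balancedAssignments n k := by
  refine ⟨fun i => hy.1 _, fun j => ?_⟩
  refine Eq.trans (congrArg (k * ·) ?_) (hy.2 j)
  exact Nat.card_congr (e.subtypeEquiv fun i => Iff.rfl)

lemma comp_swap_eq_add (y : Fin n → ℂ) {a b : Fin n} (hab : a ≠ b) :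
    y ∘ Equiv.swap a b = y + (Pi.single a (y b - y a) + Pi.single b (y a - y b)) := by
  ext i
  rcases eq_or_ne i a with rfl | h1
  · simp [hab]
  · rcases eq_or_ne i b with rfl | h2
    · simp [h1]
    · simp [h1, h2, Equiv.swap_apply_of_ne_of_ne]

/-- The overlap after the swap is `n - 2r` with `r = 1 - Re (y b)`, and `n² - (n - 2r)² = 4nr -
4r²`. -/
lemma signalGap_comp_swap_le {y : Fin n → ℂ} (hy : ∀ i, ‖y i‖ = 1) {a b : Fin n} (hab : a ≠ b)
    (ha : y a = 1) :
    signalGap y (y ∘ Equiv.swap a b) ≤ 4 * n * (1 - (y b).re) := by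
  have hyy : ∀ i, y i * star (y i) = 1 := fun i => by
    rw [Complex.star_def, Complex.mul_conj, Complex.normSq_eq_norm_sq, hy]
    simp
  have h : ∑ i, (y ∘ Equiv.swap a b) i * star (y i) = ((n - 2 * (1 - (y b).re) : ℝ) : ℂ) := by
    rw [comp_swap_eq_add y hab]
    simp only [Pi.add_apply, add_mul, Finset.sum_add_distrib, hyy]
    have h1 : ∀ (c : Fin n) (u : ℂ), ∑ i, (Pi.single c u : Fin n → ℂ) i * star (y i) =
        u * star (y c) := by
      intro c u
      rw [Finset.sum_eq_single c] <;> simp +contextual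
    rw [h1, h1, ha]
    have h2 : y b + star (y b) = ((2 * (y b).re : ℝ) : ℂ) := by
      rw [Complex.star_def, Complex.add_conj]
    simp only [Finset.sum_const, Finset.card_univ, Fintype.card_fin, nsmul_eq_mul, star_one]
    push_cast at h2 ⊢
    linear_combination h2 - hyy b
  rw [signalGap, h, Complex.norm_real, Real.norm_eq_abs, sq_abs]
  nlinarith [sq_nonneg (1 - (y b).re)]

end Swap

/-! ### Some swap improves the likelihood with high probability. -/

section SwapProbability

variable {n : ℕ}

lemma frobSq_ofReal_smul (c : ℝ) (A : Matrix (Fin n) (Fin n) ℂ) :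
    frobSq ((c : ℂ) • A) = c ^ 2 * frobSq A := by
  simp [frobSq, Finset.mul_sum, mul_pow]

lemma sum_norm_sq_single (a : Fin n) (u : ℂ) :
    ∑ i, ‖(Pi.single a u : Fin n → ℂ) i‖ ^ 2 = ‖u‖ ^ 2 := by
  rw [Finset.sum_eq_single a] <;> simp +contextual

lemma sum_norm_sq_single_add_single_le (a b : Fin n) (u u' : ℂ) :
    ∑ i, ‖(Pi.single a u + Pi.single b u' : Fin n → ℂ) i‖ ^ 2 ≤ 2 * ‖u‖ ^ 2 + 2 * ‖u'‖ ^ 2 := by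
  rw [← sum_norm_sq_single a u, ← sum_norm_sq_single b u', Finset.mul_sum, Finset.mul_sum,
    ← Finset.sum_add_distrib]
  refine Finset.sum_le_sum fun i _ => ?_
  rw [Pi.add_apply]
  generalize (Pi.single a u : Fin n → ℂ) i = p, (Pi.single b u' : Fin n → ℂ) i = q
  have h1 := norm_add_le p q
  have h2 := norm_nonneg (p + q)
  nlinarith [sq_nonneg (‖p‖ - ‖q‖)]

lemma frobSq_symmOuter_add_phaseMatrix_le (v w : Fin n → ℂ) :
    frobSq (symmOuter v w + phaseMatrix v) ≤
      8 * ((∑ i, ‖v i‖ ^ 2) * ∑ i, ‖w i‖ ^ 2) + 2 * (∑ i, ‖v i‖ ^ 2) ^ 2 := by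
  have h1 := frobSq_add_le (symmOuter v w) (phaseMatrix v)
  have h2 := frobSq_add_le (Matrix.vecMulVec v (star w)) (Matrix.vecMulVec w (star v))
  rw [frobSq_vecMulVec, frobSq_vecMulVec] at h2
  rw [phaseMatrix, frobSq_vecMulVec] at h1
  unfold symmOuter at *
  unfold phaseMatrix
  nlinarith

lemma norm_sub_one_sq {ζ : ℂ} (hζ : ‖ζ‖ = 1) : ‖ζ - 1‖ ^ 2 = 2 * (1 - ζ.re) := by
  have h : ζ.re * ζ.re + ζ.im * ζ.im = 1 := by
    rw [← Complex.normSq_apply, Complex.normSq_eq_norm_sq, hζ, one_pow]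
  rw [← Complex.normSq_eq_norm_sq, Complex.normSq_apply]
  simp
  nlinarith

variable {Ω : Type*} [MeasurableSpace Ω] {μ : Measure Ω} [IsProbabilityMeasure μ]
  {W : Ω → Matrix (Fin n) (Fin n) ℂ}

/-- The probability that no swap of a vertex of `H₀` and a vertex of `H₁`, where `H₀` and `H₁` lie in
two color classes, improves the likelihood. -/
theorem IsGUE.measureReal_forall_swap_le (hW : IsGUE μ W) {y : Fin n → ℂ} (hy : ∀ i, ‖y i‖ = 1)
    {ζ : ℂ} (hζ : ζ.re < 1) {H₀ H₁ : Finset (Fin n)} {h : ℕ} (hh : 1 ≤ h) (hhn : 2 * h < n)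
    (hc₀ : H₀.card = h) (hc₁ : H₁.card = h) (hy₀ : ∀ a ∈ H₀, y a = 1) (hy₁ : ∀ b ∈ H₁, y b = ζ)
    {σ t u z : ℝ} (ht : 0 ≤ t) (hz : 0 ≤ z)
    (hσ : 4 * n * (1 - ζ.re) < |σ| * (2 * u - t))
    (hu : u ≤ z * √(4 * (1 - ζ.re) * (n - 2 * h))) :
    μ.real {ω | ∀ a ∈ H₀, ∀ b ∈ H₁,
        σ * frobPair (W ω) (phaseMatrix (y ∘ Equiv.swap a b) - phaseMatrix y) ≤
          signalGap y (y ∘ Equiv.swap a b)} ≤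
      2 * Real.exp (-(h * ((√(2 * Real.pi))⁻¹ * Real.exp (-(z + 1) ^ 2 / 2)))) +
        h ^ 2 * Real.exp (-(t ^ 2 / (1536 * h))) := by
  classical
  have hζ1 : ‖ζ‖ = 1 := by
    obtain ⟨b, hb⟩ := Finset.card_pos.1 (by omega : 0 < H₁.card)
    rw [← hy₁ b hb, hy b]
  have hnc : ‖ζ - 1‖ ^ 2 = 2 * (1 - ζ.re) := norm_sub_one_sq hζ1
  have hnc' : ‖1 - ζ‖ ^ 2 = 2 * (1 - ζ.re) := by rw [norm_sub_rev, hnc]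
  have hζ2 : 1 - ζ.re ≤ 2 := by
    have := Complex.abs_re_le_norm ζ
    rw [hζ1, abs_le] at this
    linarith
  have hne : ∀ a ∈ H₀, ∀ b ∈ H₁, a ≠ b := by
    rintro a ha b hb rfl
    have := hy₀ a ha
    rw [hy₁ a hb] at this
    simp [this] at hζ
  have hdisj : Disjoint H₀ H₁ := Finset.disjoint_left.2 fun a ha hb => hne a ha a hb rfl
  -- `ε` is a sign of `σ`; absorbing it into the matrices treats both signs at once.
  obtain ⟨ε, hε, hεσ⟩ : ∃ ε : ℝ, ε ^ 2 = 1 ∧ |σ| = ε * σ := by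
    rcases le_total 0 σ with hs | hs
    · exact ⟨1, by norm_num, by rw [abs_of_nonneg hs, one_mul]⟩
    · exact ⟨-1, by norm_num, by rw [abs_of_nonpos hs]; ring⟩
  set H := H₀ ∪ H₁ with hH
  have hHc : H.card = 2 * h := by rw [hH, Finset.card_union_of_disjoint hdisj]; omega
  -- `y = w + w'`: the part `w` off `H` gives the independent main terms, and the part `w'` on `H`
  -- goes into the remainder.
  let w : Fin n → ℂ := fun i => if i ∈ H then 0 else y i
  let w' : Fin n → ℂ := fun i => if i ∈ H then y i else 0
  have hww : w + w' = y := by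
    ext i
    by_cases hi : i ∈ H <;> simp [w, w', hi]
  have hw0 : ∀ i ∈ H, w i = 0 := fun i hi => by simp [w, hi]
  have hw's : ∑ i, ‖w' i‖ ^ 2 = 2 * h := by
    have : ∀ i, ‖w' i‖ ^ 2 = if i ∈ H then 1 else 0 := fun i => by
      by_cases hi : i ∈ H <;> simp [w', hi, hy]
    simp_rw [this]
    rw [Finset.sum_ite_mem, Finset.univ_inter, Finset.sum_const, hHc]
    simp
  have hws : ∑ i, ‖w i‖ ^ 2 = n - 2 * h := by
    have : ∀ i, ‖w i‖ ^ 2 = 1 - ‖w' i‖ ^ 2 := fun i => by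
      by_cases hi : i ∈ H <;> simp [w, w', hi, hy]
    simp_rw [this]
    rw [Finset.sum_sub_distrib, hw's]
    simp
  -- `c i` is the change of the value at a vertex `i` of `H` under a swap; it depends only on the
  -- side on which `i` lies.
  let c : Fin n → ℂ := fun i => if i ∈ H₀ then ζ - 1 else 1 - ζ
  have hcn : ∀ i, ‖c i‖ ^ 2 = 2 * (1 - ζ.re) := fun i => by
    by_cases hi : i ∈ H₀ <;> simp [c, hi, hnc, hnc']
  let A : Fin n → Matrix (Fin n) (Fin n) ℂ := fun i =>
    if i ∈ H then (ε : ℂ) • symmOuter (Pi.single i (c i)) w else 0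
  have hherm : ∀ (B : Matrix (Fin n) (Fin n) ℂ), B.IsHermitian → ((ε : ℂ) • B).IsHermitian := by
    intro B hB
    rw [Matrix.IsHermitian, Matrix.conjTranspose_smul, hB.eq]
    simp
  have hA : ∀ i, (A i).IsHermitian := by
    intro i
    by_cases hi : i ∈ H
    · simp only [A, hi, if_true]
      exact hherm _ (symmOuter_isHermitian _ _)
    · simp [A, hi]
  have hAo : ∀ i j, i ≠ j → frobPair (A i) (A j) = 0 := by
    intro i j hij
    by_cases hi : i ∈ H
    · by_cases hj : j ∈ H
      · simp only [A, hi, hj, if_true]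
        rw [frobPair_smul, frobPair_comm, frobPair_smul,
          frobPair_symmOuter_single H w hw0 hj hi hij.symm]
        simp
      · simp [A, hj, frobPair]
    · simp [A, hi, frobPair]
  have hAv : ∀ i ∈ H, frobSq (A i) = 4 * (1 - ζ.re) * (n - 2 * h) := by
    intro i hi
    simp only [A, hi, if_true]
    rw [frobSq_ofReal_smul, hε, frobSq_symmOuter_single w (hw0 i hi), hws, hcn]
    ring
  have hn0 : (0 : ℝ) < n - 2 * h := by
    have : (2 * h : ℝ) < n := by exact_mod_cast hhn
    linarith
  have hV : 0 < 4 * (1 - ζ.re) * (n - 2 * h) := by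
    have : 0 < 1 - ζ.re := by linarith
    positivity
  set q := (√(2 * Real.pi))⁻¹ * Real.exp (-(z + 1) ^ 2 / 2) with hq
  have htail : ∀ i ∈ H, q ≤ μ.real {ω | u < frobPair (W ω) (A i)} := by
    intro i hi
    have hl := hW.hasLaw_frobPair (hA i)
    rw [hAv i hi] at hl
    refine exp_le_measureReal_gt_of_hasLaw_gaussianReal hl (Real.toNNReal_pos.2 hV) hz ?_
    rwa [Real.coe_toNNReal _ hV.le]
  have hind := hW.iIndepFun_frobPair hA hAo
  have hmeas : ∀ i, AEMeasurable (fun ω => frobPair (W ω) (A i)) μ :=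
    fun i => (hW.hasLaw_frobPair (hA i)).aemeasurable
  have hE₀ : μ.real {ω | ∀ a ∈ H₀, frobPair (W ω) (A a) ≤ u} ≤ Real.exp (-(h * q)) := by
    have := measureReal_forall_le_le_exp H₀ hmeas hind (u := u) (q := q)
      fun i hi => htail i (Finset.mem_union_left _ hi)
    rwa [hc₀] at this
  have hE₁ : μ.real {ω | ∀ a ∈ H₁, frobPair (W ω) (A a) ≤ u} ≤ Real.exp (-(h * q)) := by
    have := measureReal_forall_le_le_exp H₁ hmeas hind (u := u) (q := q)
      fun i hi => htail i (Finset.mem_union_right _ hi)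
    rwa [hc₁] at this
  let v : Fin n → Fin n → Fin n → ℂ := fun a b => Pi.single a (ζ - 1) + Pi.single b (1 - ζ)
  let R : Fin n → Fin n → Matrix (Fin n) (Fin n) ℂ := fun a b =>
    symmOuter (v a b) w' + phaseMatrix (v a b)
  have hRh : ∀ a b, (R a b).IsHermitian := fun a b =>
    (symmOuter_isHermitian _ _).add (phaseMatrix_isHermitian _)
  have hh1 : (1 : ℝ) ≤ h := by exact_mod_cast hh
  -- With `‖v‖² ≤ 16` and `‖w'‖² = 2h` the bound is `8·16·2h + 2·16² = 256h + 512`, which is at most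
  -- `768h` because `h ≥ 1`.
  have hRv : ∀ a b, frobSq (R a b) ≤ 768 * h := by
    intro a b
    have h1 := frobSq_symmOuter_add_phaseMatrix_le (v a b) w'
    have h2 := sum_norm_sq_single_add_single_le a b (ζ - 1) (1 - ζ)
    rw [hnc, hnc'] at h2
    rw [hw's] at h1
    have h3 : ∑ i, ‖v a b i‖ ^ 2 ≤ 16 := by
      refine h2.trans ?_
      linarith
    have h4 : 0 ≤ ∑ i, ‖v a b i‖ ^ 2 := by positivity
    refine h1.trans ?_
    nlinarith
  have hdec : ∀ a ∈ H₀, ∀ b ∈ H₁, (ε : ℂ) •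
      (phaseMatrix (y ∘ Equiv.swap a b) - phaseMatrix y) = A a + A b + (ε : ℂ) • R a b := by
    intro a ha b hb
    have hbH₀ : b ∉ H₀ := fun hb' => hne b hb' b hb rfl
    have haH : a ∈ H := Finset.mem_union_left _ ha
    have hbH : b ∈ H := Finset.mem_union_right _ hb
    rw [comp_swap_eq_add y (hne a ha b hb), hy₀ a ha, hy₁ b hb, phaseMatrix_add_sub]
    nth_rewrite 1 [← hww]
    rw [symmOuter_add_right, symmOuter_add_left _ _ w]
    simp only [A, haH, hbH, if_true, c, ha, hbH₀, if_false, R, v]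
    rw [smul_add, smul_add, smul_add, smul_add]
    abel
  have hres : ∀ a b, μ.real {ω | t ≤ -(ε * frobPair (W ω) (R a b))} ≤
      Real.exp (-(t ^ 2 / (1536 * h))) := by
    intro a b
    have hl := gaussianReal_const_mul (hW.hasLaw_frobPair (hRh a b)) (-ε)
    rw [mul_zero] at hl
    -- This is the optimal Chernoff parameter for variance `768h`.
    have hb := measureReal_ge_le_exp_of_hasLaw_gaussianReal hl t
      (t := t / (768 * h)) (by positivity)
    simp only [neg_mul] at hb
    refine hb.trans ?_
    rw [Real.exp_le_exp]
    simp only [NNReal.coe_mul, NNReal.coe_mk, Real.coe_toNNReal _ (frobSq_nonneg _), neg_sq, hε,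
      one_mul]
    have h5 : frobSq (R a b) * (t / (768 * h)) ^ 2 / 2 ≤ 768 * h * (t / (768 * h)) ^ 2 / 2 := by
      gcongr
      exact hRv a b
    have h6 : 768 * h * (t / (768 * h)) ^ 2 / 2 = t ^ 2 / (1536 * h) := by field_simp; ring
    have h7 : t / (768 * h) * t = 2 * (t ^ 2 / (1536 * h)) := by field_simp; ring
    linarith
  -- The vertices `a` and `b` can be chosen separately, since the main term is a sum `A a + A b`. If
  -- both exceed `u` and the remainder stays above `-t`, the noise exceeds `|σ|(2u - t)`, hence the
  -- gap.
  have hsub : {ω | ∀ a ∈ H₀, ∀ b ∈ H₁,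
        σ * frobPair (W ω) (phaseMatrix (y ∘ Equiv.swap a b) - phaseMatrix y) ≤
          signalGap y (y ∘ Equiv.swap a b)} ⊆
      ({ω | ∀ a ∈ H₀, frobPair (W ω) (A a) ≤ u} ∪ {ω | ∀ a ∈ H₁, frobPair (W ω) (A a) ≤ u}) ∪
      ⋃ p ∈ H₀ ×ˢ H₁, {ω | t ≤ -(ε * frobPair (W ω) (R p.1 p.2))} := by
    intro ω hω
    by_contra hcon
    simp only [Set.mem_union, Set.mem_ofPred_eq, Set.mem_iUnion, not_or, not_exists,
      Finset.mem_product, Prod.forall, not_le, not_forall] at hcon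
    obtain ⟨⟨⟨a, ha, hga⟩, ⟨b, hb, hgb⟩⟩, hr⟩ := hcon
    have hr' := hr a b ⟨ha, hb⟩
    have h1 := hω a ha b hb
    have h2 := signalGap_comp_swap_le hy (hne a ha b hb) (hy₀ a ha)
    rw [hy₁ b hb] at h2
    have h3 := congrArg (frobPair (W ω)) (hdec a ha b hb)
    rw [frobPair_smul, frobPair_add, frobPair_add, frobPair_smul] at h3
    set Q := frobPair (W ω) (phaseMatrix (y ∘ Equiv.swap a b) - phaseMatrix y)
    have h4 : σ * Q = |σ| * (ε * Q) := by
      rw [hεσ]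
      linear_combination (-(σ * Q)) * hε
    have h5 : |σ| * (2 * u - t) ≤ |σ| * (ε * Q) := by
      refine mul_le_mul_of_nonneg_left ?_ (abs_nonneg σ)
      rw [h3]
      linarith
    linarith
  refine (measureReal_mono hsub (measure_ne_top _ _)).trans
    ((measureReal_union_le _ _).trans (add_le_add ?_ ?_))
  · refine (measureReal_union_le _ _).trans ?_
    linarith
  · refine (measureReal_biUnion_finset_le _ _).trans ((Finset.sum_le_sum fun p _ =>
      hres p.1 p.2).trans_eq ?_)
    rw [Finset.sum_const, Finset.card_product, hc₀, hc₁, nsmul_eq_mul]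
    push_cast
    ring

end SwapProbability

/-! ### Failure above the critical variance. -/

section Supercritical

lemma exists_subset_color_class {k m h : ℕ} {y : Fin (k * m) → ℂ}
    (hy : y ∈ balancedAssignments (k * m) k) (j : Fin k) (hh : h ≤ m) :
    ∃ H : Finset (Fin (k * m)), H.card = h ∧ ∀ a ∈ H, y a = color k j := by
  classical
  have hc : (Finset.univ.filter fun i => y i = color k j).card = m := by
    have := Nat.eq_of_mul_eq_mul_left j.pos (hy.2 j)
    rwa [Nat.card_eq_fintype_card, Fintype.card_subtype] at this
  obtain ⟨H, hH, hHc⟩ := Finset.exists_subset_card_eq (hc.symm ▸ hh)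
  exact ⟨H, hHc, fun a ha => (Finset.mem_filter.1 (hH ha)).2⟩

/-- `P` is constant on the phase class, so success makes `y` itself a minimizer, and no balanced `x`
can beat it. -/
lemma le_signalGap_of_mem_phaseClass {n k : ℕ} {y : Fin n → ℂ} (hy : y ∈ balancedAssignments n k)
    {yhat : Matrix (Fin n) (Fin n) ℂ → Fin n → ℂ} (hyhat : IsMLE k yhat) (σ : ℝ)
    (W : Matrix (Fin n) (Fin n) ℂ) (h : yhat (observation y σ W) ∈ phaseClass k y)
    {x : Fin n → ℂ} (hx : x ∈ balancedAssignments n k) :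
    σ * frobPair W (phaseMatrix x - phaseMatrix y) ≤ signalGap y x := by
  have h2 := (hyhat (observation y σ W)).2 x hx
  rw [phaseMatrix_eq_of_mem_phaseClass h, frobSq_sub_phaseMatrix_le_iff
    (norm_of_mem_balancedAssignments hy) (norm_of_mem_balancedAssignments hx)] at h2
  have h4 := frobPair_observation_sub (x := x) (norm_of_mem_balancedAssignments hy) σ W
  linarith

lemma color_zero {k : ℕ} (hk : 0 < k) : color k ⟨0, hk⟩ = 1 := by
  simp [color]

lemma color_one_re {k : ℕ} (hk : 1 < k) :
    (color k ⟨1, hk⟩).re = Real.cos (2 * Real.pi / k) := by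
  have : (2 * Real.pi * Complex.I * ((1 : ℕ) : ℂ) / k : ℂ) =
      ((2 * Real.pi / k : ℝ) : ℂ) * Complex.I := by
    push_cast; ring
  rw [color, this, Complex.exp_ofReal_mul_I_re]

/-- A non-asymptotic bound for the probability that the maximum likelihood estimator succeeds. -/
theorem IsGUE.measureReal_mle_mem_le {k m : ℕ} (hk : 2 ≤ k) {Ω : Type*} [MeasurableSpace Ω]
    {μ : Measure Ω} [IsProbabilityMeasure μ] {W : Ω → Matrix (Fin (k * m)) (Fin (k * m)) ℂ}
    (hW : IsGUE μ W) {y : Fin (k * m) → ℂ} (hy : y ∈ balancedAssignments (k * m) k)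
    {yhat : Matrix (Fin (k * m)) (Fin (k * m)) ℂ → Fin (k * m) → ℂ} (hyhat : IsMLE k yhat)
    {h : ℕ} (hh : 1 ≤ h) (hhm : h < m) {σ t u z : ℝ} (ht : 0 ≤ t) (hz : 0 ≤ z)
    (hσ : 4 * (k * m : ℕ) * (1 - Real.cos (2 * Real.pi / k)) < |σ| * (2 * u - t))
    (hu : u ≤ z * √(4 * (1 - Real.cos (2 * Real.pi / k)) * ((k * m : ℕ) - 2 * h))) :
    μ.real {ω | yhat (observation y σ (W ω)) ∈ phaseClass k y} ≤
      2 * Real.exp (-(h * ((√(2 * Real.pi))⁻¹ * Real.exp (-(z + 1) ^ 2 / 2)))) +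
        h ^ 2 * Real.exp (-(t ^ 2 / (1536 * h))) := by
  -- Colors 0 and 1 are adjacent, which makes the swap as cheap as possible.
  obtain ⟨H₀, hc₀, hy₀⟩ := exists_subset_color_class hy ⟨0, by omega⟩ hhm.le
  obtain ⟨H₁, hc₁, hy₁⟩ := exists_subset_color_class hy ⟨1, by omega⟩ hhm.le
  have hre := color_one_re (k := k) (by omega)
  have hβ := one_sub_cos_two_pi_div_pos hk
  rw [← hre] at hσ hu
  refine le_trans (measureReal_mono ?_ (measure_ne_top _ _))
    (hW.measureReal_forall_swap_le (norm_of_mem_balancedAssignments hy) (by linarith) hh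
      (by nlinarith) hc₀ hc₁ (fun a ha => (hy₀ a ha).trans (color_zero _)) hy₁ ht hz hσ hu)
  intro ω hω a _ b _
  exact le_signalGap_of_mem_phaseClass hy hyhat σ (W ω) hω
    (comp_swap_mem_balancedAssignments hy _)

/-- For `L = log n` this is, up to a constant, the logarithm of `n` times the tail lower bound at
level `θ√(2L)`. Its leading term is `(1 - θ²)L`. -/
lemma tendsto_sub_sq_sqrt_atTop {θ : ℝ} (hθ : 0 ≤ θ) (hθ1 : θ < 1) :
    Tendsto (fun L : ℝ => L - (θ * √(2 * L) + 1) ^ 2 / 2) atTop atTop := by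
  have hs : Tendsto (fun L : ℝ => √(2 * L)) atTop atTop :=
    Real.tendsto_sqrt_atTop.comp (tendsto_id.const_mul_atTop two_pos)
  have hc : 0 < (1 - θ ^ 2) / 2 := by nlinarith
  have h1 : Tendsto (fun s : ℝ => s * ((1 - θ ^ 2) / 2 * s + -θ) + -(1 / 2)) atTop atTop :=
    tendsto_atTop_add_const_right _ _ (tendsto_id.atTop_mul_atTop₀
      (tendsto_atTop_add_const_right _ _ (tendsto_id.const_mul_atTop hc)))
  refine (h1.comp hs).congr' ?_
  filter_upwards [eventually_ge_atTop 0] with L hL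
  have h2 : √(2 * L) ^ 2 = 2 * L := Real.sq_sqrt (by linarith)
  simp only [Function.comp]
  linear_combination (1 / 2 : ℝ) * h2

/-- The constants used above the critical variance. -/
lemma exists_constants {δ β : ℝ} (hδ : 0 < δ) (hβ : 0 < β) :
    ∃ ρ ρ' θ : ℝ, ∃ J : ℕ, 0 < ρ ∧ ρ ^ 2 * (1 + δ) = 1 ∧ ρ < ρ' ∧ 0 ≤ θ ∧ θ < 1 ∧ 2 ≤ J ∧
      ρ' ^ 2 ≤ θ ^ 2 * (1 - 1 / J) ∧ 4608 ≤ (ρ' - ρ) ^ 2 * (8 * β) * J := by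
  have h1 : 1 < √(1 + δ) := by
    rw [Real.lt_sqrt (by norm_num)]; linarith
  have hsq : √(1 + δ) ^ 2 = 1 + δ := Real.sq_sqrt (by linarith)
  set ρ := (√(1 + δ))⁻¹ with hρ
  have hρ0 : 0 < ρ := by positivity
  have hρ1 : ρ < 1 := inv_lt_one_of_one_lt₀ h1
  have hJ : ∀ᶠ J : ℕ in atTop, ((1 + ρ) / 2) ^ 2 <
      ((1 + (1 + ρ) / 2) / 2) ^ 2 * (1 - 1 / (J : ℝ)) := by
    have ht : Tendsto (fun J : ℕ => ((1 + (1 + ρ) / 2) / 2) ^ 2 * (1 - 1 / (J : ℝ))) atTop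
        (𝓝 (((1 + (1 + ρ) / 2) / 2) ^ 2 * (1 - 0))) :=
      (tendsto_const_nhds.sub tendsto_one_div_atTop_nhds_zero_nat).const_mul _
    refine ht.eventually_const_lt ?_
    nlinarith
  have hJ2 : ∀ᶠ J : ℕ in atTop, 4608 ≤ ((1 + ρ) / 2 - ρ) ^ 2 * (8 * β) * (J : ℝ) := by
    have hpos : 0 < ((1 + ρ) / 2 - ρ) ^ 2 * (8 * β) := by
      have : 0 < (1 + ρ) / 2 - ρ := by linarith
      positivity
    exact (tendsto_natCast_atTop_atTop.const_mul_atTop hpos).eventually_ge_atTop _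
  obtain ⟨J, h3, h4, h5⟩ := (hJ.and (hJ2.and (eventually_ge_atTop 2))).exists
  -- `ρ'` lies halfway between `ρ = 1/√(1+δ)` and 1, and `θ` halfway between `ρ'` and 1. A large `J`
  -- then makes both the discarded set `H` and the remainder small.
  refine ⟨ρ, (1 + ρ) / 2, (1 + (1 + ρ) / 2) / 2, J, hρ0, ?_, by linarith, by linarith, by linarith,
    h5, h3.le, h4⟩
  rw [hρ, inv_pow, hsq, inv_mul_cancel₀ (by linarith)]

lemma signal_lt_noise {n β L δ ρ ρ' σ : ℝ} (hn : 0 < n) (hβ : 0 < β) (hL : 0 < L) (hρ0 : 0 < ρ)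
    (hρ : ρ ^ 2 * (1 + δ) = 1) (hρ' : ρ < ρ') (hσ : (1 + δ) * (n * β / (2 * L)) < σ ^ 2) :
    4 * n * β < |σ| * (2 * (ρ' * √(8 * β * n * L)) - (ρ' - ρ) * √(8 * β * n * L)) := by
  have hΛ : √(8 * β * n * L) ^ 2 = 8 * β * n * L := Real.sq_sqrt (by positivity)
  have h1 : 2 * (ρ' * √(8 * β * n * L)) - (ρ' - ρ) * √(8 * β * n * L) =
      (ρ' + ρ) * √(8 * β * n * L) := by ring
  rw [h1]
  have hρ'0 : 0 < ρ' := hρ0.trans hρ'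
  refine lt_of_pow_lt_pow_left₀ 2 (by positivity) ?_
  rw [mul_pow |σ|, sq_abs, mul_pow (ρ' + ρ), hΛ]
  have h2 : 4 * ρ ^ 2 ≤ (ρ' + ρ) ^ 2 := by nlinarith
  have h3 : (1 + δ) * (n * β / (2 * L)) * (4 * ρ ^ 2 * (8 * β * n * L)) =
      (4 * n * β) ^ 2 * (ρ ^ 2 * (1 + δ)) := by
    field_simp; ring
  rw [hρ, mul_one] at h3
  rw [← h3]
  calc (1 + δ) * (n * β / (2 * L)) * (4 * ρ ^ 2 * (8 * β * n * L))
      < σ ^ 2 * (4 * ρ ^ 2 * (8 * β * n * L)) := mul_lt_mul_of_pos_right hσ (by positivity)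
    _ ≤ σ ^ 2 * ((ρ' + ρ) ^ 2 * (8 * β * n * L)) :=
      mul_le_mul_of_nonneg_left (mul_le_mul_of_nonneg_right h2 (by positivity)) (sq_nonneg _)

lemma threshold_le {n β L ρ' θ J h : ℝ} (hn : 0 < n) (hβ : 0 < β) (hL : 0 < L) (hJ : 0 < J)
    (hθ : 0 ≤ θ) (hρ' : ρ' ^ 2 ≤ θ ^ 2 * (1 - 1 / J)) (hh : 2 * h * J ≤ n) :
    ρ' * √(8 * β * n * L) ≤ θ * √(2 * L) * √(4 * β * (n - 2 * h)) := by
  have hΛ : √(8 * β * n * L) ^ 2 = 8 * β * n * L := Real.sq_sqrt (by positivity)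
  refine le_trans (Real.le_sqrt_of_sq_le (y := θ ^ 2 * (2 * L) * (4 * β * (n - 2 * h))) ?_) ?_
  · rw [mul_pow, hΛ]
    have h1 : 2 * h ≤ n * (1 / J) := by
      rw [mul_one_div, le_div_iff₀ hJ]; exact hh
    have h2 : ρ' ^ 2 * n ≤ θ ^ 2 * (n - 2 * h) := by
      calc ρ' ^ 2 * n ≤ θ ^ 2 * (1 - 1 / J) * n := mul_le_mul_of_nonneg_right hρ' hn.le
        _ = θ ^ 2 * (n - n * (1 / J)) := by ring
        _ ≤ _ := mul_le_mul_of_nonneg_left (by linarith) (sq_nonneg _)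
    have h3 := mul_le_mul_of_nonneg_left h2 (by positivity : 0 ≤ 8 * β * L)
    linarith
  · rw [Real.sqrt_mul (by positivity), Real.sqrt_mul (by positivity), Real.sqrt_sq hθ]

/-- Since `4608 = 3·1536`, the exponent is at least `3L`, while the number of pairs satisfies `h² ≤
n² = exp(2L)`. -/
lemma residual_le {n β L τ J h : ℝ} (hβ : 0 < β) (hL : 0 < L) (hexp : Real.exp L = n)
    (hh0 : 0 < h) (hhn : h ≤ n) (hJ : 4608 ≤ τ ^ 2 * (8 * β) * J) (hJh : J * h ≤ n) :
    h ^ 2 * Real.exp (-((τ * √(8 * β * n * L)) ^ 2 / (1536 * h))) ≤ Real.exp (-L) := by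
  have hn : 0 < n := hh0.trans_le hhn
  have h1 : h ^ 2 ≤ Real.exp (2 * L) := by
    rw [two_mul, Real.exp_add, hexp, ← sq]
    exact pow_le_pow_left₀ hh0.le hhn 2
  have h2 : 3 * L ≤ (τ * √(8 * β * n * L)) ^ 2 / (1536 * h) := by
    rw [le_div_iff₀ (by positivity), mul_pow, Real.sq_sqrt (by positivity)]
    have h4 : 4608 * h ≤ τ ^ 2 * (8 * β) * n := by
      calc 4608 * h ≤ τ ^ 2 * (8 * β) * J * h := mul_le_mul_of_nonneg_right hJ hh0.le
        _ = τ ^ 2 * (8 * β) * (J * h) := by ring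
        _ ≤ _ := mul_le_mul_of_nonneg_left hJh (by positivity)
    have h5 := mul_le_mul_of_nonneg_left h4 hL.le
    linarith
  calc h ^ 2 * Real.exp (-((τ * √(8 * β * n * L)) ^ 2 / (1536 * h)))
      ≤ Real.exp (2 * L) * Real.exp (-(3 * L)) :=
        mul_le_mul h1 (Real.exp_le_exp.2 (neg_le_neg h2)) (Real.exp_pos _).le (Real.exp_pos _).le
    _ = Real.exp (-L) := by rw [← Real.exp_add]; ring_nf

/-- Above the critical variance the maximum likelihood estimator fails. -/
theorem tendsto_measure_mle_mem_zero {k : ℕ} (hk : 2 ≤ k)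
    {Ω : ℕ → Type*} [∀ m, MeasurableSpace (Ω m)]
    (μ : ∀ m, Measure (Ω m)) [∀ m, IsProbabilityMeasure (μ m)]
    (y : ∀ m, Fin (k * m) → ℂ) (hy : ∀ m, y m ∈ balancedAssignments (k * m) k)
    (W : ∀ m, Ω m → Matrix (Fin (k * m)) (Fin (k * m)) ℂ) (hW : ∀ m, IsGUE (μ m) (W m))
    (yhat : ∀ m, Matrix (Fin (k * m)) (Fin (k * m)) ℂ → Fin (k * m) → ℂ)
    (hyhat : ∀ m, IsMLE k (yhat m)) (σ : ℕ → ℝ) {δ : ℝ} (hδ : 0 < δ)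
    (hσ : ∀ᶠ m in atTop, (1 + δ) * criticalVariance (k * m) k < σ m ^ 2) :
    Tendsto (fun m => μ m {ω | yhat m (observation (y m) (σ m) (W m ω)) ∈ phaseClass k (y m)})
      atTop (𝓝 0) := by
  have hβ := one_sub_cos_two_pi_div_pos hk
  obtain ⟨ρ, ρ', θ, J, hρ0, hρ, hρ', hθ0, hθ1, hJ2, hJθ, hJ⟩ := exists_constants hδ hβ
  set C : ℝ := (√(2 * Real.pi))⁻¹ / (2 * k * J) with hC
  have hk0 : (2 : ℝ) ≤ k := by exact_mod_cast hk
  have hJ0 : (2 : ℝ) ≤ J := by exact_mod_cast hJ2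
  have hpi := Real.pi_pos
  have hC0 : 0 < C := by positivity
  have hL := tendsto_log_natCast_mul_atTop hk
  have hlim : Tendsto (fun m : ℕ => ENNReal.ofReal
      (2 * Real.exp (-(C * Real.exp (Real.log ((k * m : ℕ) : ℝ) -
        (θ * √(2 * Real.log ((k * m : ℕ) : ℝ)) + 1) ^ 2 / 2))) +
        Real.exp (-Real.log ((k * m : ℕ) : ℝ)))) atTop (𝓝 0) := by
    have h1 := (Real.tendsto_exp_atTop.comp
      ((tendsto_sub_sq_sqrt_atTop hθ0 hθ1).comp hL)).const_mul_atTop hC0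
    have h2 := (Real.tendsto_exp_neg_atTop_nhds_zero.comp h1).const_mul 2
    have h3 := h2.add (Real.tendsto_exp_neg_atTop_nhds_zero.comp hL)
    have h4 := ENNReal.tendsto_ofReal h3
    simpa [Function.comp_def] using h4
  refine tendsto_of_tendsto_of_tendsto_of_le_of_le' tendsto_const_nhds hlim
    (Eventually.of_forall fun m => zero_le) ?_
  filter_upwards [hσ, eventually_ge_atTop J] with m hm hmJ
  rw [← ofReal_measureReal]
  refine ENNReal.ofReal_le_ofReal ?_
  -- The division rounds down, but `m < J(h+1) ≤ 2Jh` still gives `h ≥ n/(2kJ)`, the source of the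
  -- constant `C`.
  obtain ⟨h, hh⟩ : ∃ h, h = m / J := ⟨_, rfl⟩
  have hh1 : 1 ≤ h := hh ▸ (Nat.one_le_div_iff (by omega)).2 hmJ
  have hJh : J * h ≤ m := hh ▸ Nat.mul_div_le m J
  have hmJh : m < J * (h + 1) := hh ▸ Nat.lt_mul_div_succ m (by omega)
  have hhm : h < m := by nlinarith
  have hn2 : 2 ≤ k * m := by nlinarith
  have hh1' : (1 : ℝ) ≤ h := by exact_mod_cast hh1
  have hJh' : (J : ℝ) * h ≤ m := by exact_mod_cast hJh
  have hmJh' : (m : ℝ) < J * (h + 1) := by exact_mod_cast hmJh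
  have hn2' : (2 : ℝ) ≤ (k * m : ℕ) := by exact_mod_cast hn2
  have hnkm : ((k * m : ℕ) : ℝ) = k * m := by push_cast; rfl
  have hm0 : (0 : ℝ) ≤ m := Nat.cast_nonneg m
  have hn2m : 2 * (m : ℝ) ≤ (k * m : ℕ) := by rw [hnkm]; nlinarith
  have hnJh : ((k * m : ℕ) : ℝ) ≤ 2 * k * J * h := by
    rw [hnkm]
    have : (m : ℝ) ≤ 2 * J * h := by nlinarith
    nlinarith
  unfold criticalVariance at hm
  set β := 1 - Real.cos (2 * Real.pi / k)
  set n : ℝ := ((k * m : ℕ) : ℝ) with hn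
  have hn0 : 0 < n := by linarith
  set L := Real.log n with hLdef
  have hL0 : 0 < L := Real.log_pos (by linarith)
  have hexpL : Real.exp L = n := Real.exp_log hn0
  have hbound := (hW m).measureReal_mle_mem_le hk (hy m) (hyhat m) hh1 hhm
    (mul_nonneg (sub_nonneg.2 hρ'.le) (Real.sqrt_nonneg _)) (by positivity)
    (signal_lt_noise hn0 hβ hL0 hρ0 hρ hρ' hm)
    (threshold_le hn0 hβ hL0 (by linarith) hθ0 hJθ (by linarith))
  refine hbound.trans (add_le_add ?_ (residual_le hβ hL0 hexpL (by linarith) ?_ hJ (by linarith)))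
  · refine mul_le_mul_of_nonneg_left (Real.exp_le_exp.2 (neg_le_neg ?_)) zero_le_two
    rw [sub_eq_add_neg, Real.exp_add, hexpL, hC, neg_div]
    set E := Real.exp (-((θ * √(2 * L) + 1) ^ 2 / 2))
    have hE : 0 < E := Real.exp_pos _
    have h1 : n / (2 * k * J) ≤ h := by
      rw [div_le_iff₀ (by positivity)]; linarith
    calc (√(2 * Real.pi))⁻¹ / (2 * k * J) * (n * E)
        = n / (2 * k * J) * ((√(2 * Real.pi))⁻¹ * E) := by ring
      _ ≤ h * ((√(2 * Real.pi))⁻¹ * E) := mul_le_mul_of_nonneg_right h1 (by positivity)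
  · have : (h : ℝ) < m := by exact_mod_cast hhm
    linarith

end Supercritical

theorem theorem3 (k : ℕ) (hk : 2 ≤ k)
    {Ω : ℕ → Type*} [∀ m, MeasurableSpace (Ω m)]
    (μ : ∀ m, Measure (Ω m)) [∀ m, IsProbabilityMeasure (μ m)]
    -- there are `n = k * m` vertices, and `m` tends to infinity
    (y : ∀ m, Fin (k * m) → ℂ) (hy : ∀ m, y m ∈ balancedAssignments (k * m) k)
    (W : ∀ m, Ω m → Matrix (Fin (k * m)) (Fin (k * m)) ℂ) (hW : ∀ m, IsGUE (μ m) (W m))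
    (yhat : ∀ m, Matrix (Fin (k * m)) (Fin (k * m)) ℂ → Fin (k * m) → ℂ)
    (hyhat : ∀ m, IsMLE k (yhat m))
    (σ : ℕ → ℝ) (δ : ℝ) (hδ : 0 < δ) :
    ((∀ᶠ m in atTop, σ m ^ 2 < (1 - δ) * criticalVariance (k * m) k) →
      Tendsto (fun m => μ m {ω | yhat m (observation (y m) (σ m) (W m ω)) ∈ phaseClass k (y m)})
        atTop (𝓝 1)) ∧
    ((∀ᶠ m in atTop, (1 + δ) * criticalVariance (k * m) k < σ m ^ 2) →
      Tendsto (fun m => μ m {ω | yhat m (observation (y m) (σ m) (W m ω)) ∈ phaseClass k (y m)})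
        atTop (𝓝 0)) := by
  exact ⟨tendsto_measure_mle_mem_one hk μ y hy W hW yhat hyhat σ hδ,
    tendsto_measure_mle_mem_zero hk μ y hy W hW yhat hyhat σ hδ⟩
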